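/- Let $\mathcal H_A,\mathcal H_B$ be finite-dimensional complex Hilbert spaces of dimensions $d_A,d_B$, with $d_{AB}:=d_Ad_B\ge 2$, let $\mathcal H=\mathcal H_A\otimes\mathcal H_B$, and let $\mathcal S(\mathcal H)$ be the set of states on $\mathcal H$ (positive semidefinite operators of trace one). For $\rho,\gamma\in\mathcal S(\mathcal H)$ let the Belavkin–Staszewski entropy be $$\widehat D(\rho\Vert\gamma)=\begin{cases}\operatorname{tr}\big[\rho\log(\rho^{1/2}\gamma^{-1}\rho^{1/2})\big] & \text{if }\ker\gamma\subseteq\ker\rho,\\ +\infty&\text{otherwise,}\end{cases}$$ where the inverse and the logarithm are taken on the support (and are $0$ on the kernel). Let $\mathrm{SEP}_{AB}\subset\mathcal S(\mathcal H)$ be the set of separable states, that is, the convex hull of the product states $\alpha\otimes\beta$ with $\alpha\in\mathcal S(\mathcal H_A)$, $\beta\in\mathcal S(\mathcal H_B)$, and set $\widehat D_{\mathrm{SEP}_{AB}}(\rho)=\inf_{\gamma\in\mathrm{SEP}_{AB}}\widehat D(\rho\Vert\gamma)$. Let $\varepsilon\in[0,1]$ and let $\rho,\sigma\in\mathcal S(\mathcal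 H)$ satisfy $\tfrac12\|\rho-\sigma\|_1\le\varepsilon$, where $\|X\|_1=\operatorname{tr}|X|$. Then $\widehat D_{\mathrm{SEP}_{AB}}(\rho)$ and $\widehat D_{\mathrm{SEP}_{AB}}(\sigma)$ are finite and $$\big|\widehat D_{\mathrm{SEP}_{AB}}(\rho)-\widehat D_{\mathrm{SEP}_{AB}}(\sigma)\big|\le\varepsilon\log\min\{d_A,d_B\}+(1+\varepsilon)\,g_{d_{AB}}\!\Big(\frac{\varepsilon}{1+\varepsilon}\Big).$$ Here $g_d(p)=\frac{d}{p^{1/d}}h(p)-\log(1-p^{1/d})$ for $p\in(0,1)$, $g_d(0)=0$, $h(p)=-p\log p-(1-p)\log(1-p)$ is the binary entropy, and $\log$ is the natural logarithm. -/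

import Mathlib

open scoped Kronecker ComplexOrder

noncomputable section

namespace BSEntanglement

variable {n a b : Type*} [Fintype n] [DecidableEq n] [Fintype a] [DecidableEq a]
  [Fintype b] [DecidableEq b]

/-- Quantum states on `ℂⁿ` (density matrices): positive semidefinite matrices of trace one. -/
def states (n : Type*) [Fintype n] : Set (Matrix n n ℂ) :=
  {ρ | ρ.PosSemidef ∧ ρ.trace = 1}

/-- The trace norm `‖X‖₁ = tr |X|`, where `|X| = (Xᴴ X)^{1/2}`. -/
def traceNorm (X : Matrix n n ℂ) : ℝ :=
  (cfc Real.sqrt (X.conjTranspose * X)).trace.re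

/-- The square root of a positive semidefinite matrix. -/
def sqrtM (A : Matrix n n ℂ) : Matrix n n ℂ := cfc Real.sqrt A

/-- The inverse of a Hermitian matrix on its support (Moore-Penrose inverse): it inverts the
non-zero eigenvalues and keeps the kernel, because `0⁻¹ = 0` in `ℝ`. -/
def pinvM (A : Matrix n n ℂ) : Matrix n n ℂ := cfc (fun x : ℝ => x⁻¹) A

/-- The natural logarithm of a positive semidefinite matrix on its support: it is `0` on the
kernel, because `Real.log 0 = 0`. -/
def logM (A : Matrix n n ℂ) : Matrix n n ℂ := cfc Real.log A

open Classical in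
/-- The Belavkin-Staszewski entropy: `tr[ρ log(ρ^{1/2} σ⁻¹ ρ^{1/2})]` if `ker σ ⊆ ker ρ`, and
`+∞` otherwise. The trace is a real number for positive semidefinite `ρ` and `σ`. -/
def bsEntropy (ρ σ : Matrix n n ℂ) : EReal :=
  if LinearMap.ker σ.mulVecLin ≤ LinearMap.ker ρ.mulVecLin then
    (((ρ * logM (sqrtM ρ * pinvM σ * sqrtM ρ)).trace.re : ℝ) : EReal)
  else ⊤

/-- The minimal distance of `ρ` to the set `C` in terms of the BS-entropy. -/
def bsDist (C : Set (Matrix n n ℂ)) (ρ : Matrix n n ℂ) : EReal :=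
  ⨅ γ ∈ C, bsEntropy ρ γ

/-- The separable states on `ℂᵃ ⊗ ℂᵇ`: convex combinations of product states. -/
def separableStates (a b : Type*) [Fintype a] [Fintype b] : Set (Matrix (a × b) (a × b) ℂ) :=
  convexHull ℝ {γ | ∃ α ∈ states a, ∃ β ∈ states b, γ = α ⊗ₖ β}

/-- `g_d(p) = (d / p^{1/d}) h(p) - log(1 - p^{1/d})` for `p ∈ (0,1)` and `g_d(0) = 0`, with `h` the
binary entropy. -/
def gFun (d : ℕ) (p : ℝ) : ℝ :=
  if p = 0 then 0
  else (d : ℝ) / p ^ (1 / (d : ℝ)) * Real.binEntropy p - Real.log (1 - p ^ (1 / (d : ℝ)))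

end BSEntanglement

end

/-! For positive definite `γ` the entropy equals `relTrace ω γ`, that is tr[γ X log X] with X =
γ^{-1/2} ω γ^{-1/2} (`re_trace_logM_eq_relTrace`). The continuity bound comes from convexity and
almost concavity of the distance.

Convexity: `relTrace` is jointly convex (`relTrace_convex`) and the separable states form a convex
set, so the infimum is convex. Almost concavity: tr[γ X log X] = tr[X log X] - tr[(1 - γ) X log X].
The subtracted term is convex in X, since x log x is operator convex, and tr[X log X] is
superadditive; the loss is at most h(p)/δ when γ ≥ δ (`relTrace_almost_concave`). Mixing γ with the
maximally mixed state at weight s = p^{1/d} gives δ = s/d at the price -log(1 - s), and the two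
errors add up to g_d(p).

States within trace distance ε satisfy ρ + εν = σ + εμ for some states μ, ν. Both estimates, applied
to this common mixture with p = ε/(1 + ε), give the bound, because the distance lies between 0 and
log min(d_A, d_B); the upper end comes from pinching (`exists_separable_ge`).

All trace inequalities with logarithms are reduced to resolvents (`re_trace_mul_logM_le`), which are
handled by a quadratic variational formula (`resolventForm`). -/

open scoped Kronecker ComplexOrder

noncomputable section

namespace BSEntanglement

open Matrix Filter Topology

/-! ### Logarithmic sums controlled by resolvent sums. -/

section Scalar

variable {ι : Type*} [Fintype ι]

/-- The resolvent sum is the derivative in t of the logarithmic sum, which is therefore antitone. It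
tends to 0 at infinity because the weights sum to zero and log T cancels. This replaces the integral
representation of the logarithm. -/
theorem sum_mul_log_add_nonneg (w l : ι → ℝ) (hl : ∀ i, 0 ≤ l i) (hs : ∑ i, w i = 0)
    (hr : ∀ t : ℝ, 0 < t → ∑ i, w i * (l i + t)⁻¹ ≤ 0) {t : ℝ} (ht : 0 < t) :
    0 ≤ ∑ i, w i * Real.log (l i + t) := by
  set g : ℝ → ℝ := fun T => ∑ i, w i * Real.log (l i + T) with hg
  have hd : ∀ T : ℝ, 0 < T → HasDerivAt g (∑ i, w i * (l i + T)⁻¹) T := by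
    intro T hT
    refine HasDerivAt.fun_sum fun i _ => ?_
    have h1 : HasDerivAt (fun T : ℝ => l i + T) 1 T := (hasDerivAt_id T).const_add (l i)
    have h2 := (h1.log (by have := hl i; positivity)).const_mul (w i)
    simpa using h2
  have hanti : AntitoneOn g (Set.Ioi 0) := by
    refine antitoneOn_of_deriv_nonpos (convex_Ioi 0)
      (fun T hT => (hd T hT).continuousAt.continuousWithinAt) ?_ ?_
    · intro T hT
      rw [interior_Ioi] at hT
      exact (hd T hT).differentiableAt.differentiableWithinAt
    · intro T hT
      rw [interior_Ioi] at hT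
      rw [(hd T hT).deriv]
      exact hr T hT
  have hlim : Tendsto g atTop (𝓝 0) := by
    have h1 : Tendsto (fun T : ℝ => ∑ i, w i * Real.log (l i * T⁻¹ + 1)) atTop (𝓝 0) := by
      have : Tendsto (fun T : ℝ => ∑ i, w i * Real.log (l i * T⁻¹ + 1)) atTop
          (𝓝 (∑ i, w i * Real.log (l i * 0 + 1))) := by
        refine tendsto_finsetSum _ fun i _ => Tendsto.const_mul _ ?_
        refine Tendsto.log ?_ (by norm_num)
        exact (tendsto_inv_atTop_zero.const_mul _).add_const _
      simpa using this
    refine h1.congr' ?_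
    filter_upwards [eventually_gt_atTop 0] with T hT
    have : ∀ i, Real.log (l i + T) = Real.log (l i * T⁻¹ + 1) + Real.log T := by
      intro i
      have := hl i
      rw [← Real.log_mul (by positivity) hT.ne']
      congr 1
      field_simp
    simp only [hg, this, mul_add, Finset.sum_add_distrib, ← Finset.sum_mul, hs]
    ring
  refine le_of_tendsto hlim ?_
  filter_upwards [eventually_ge_atTop t] with T hT
  exact hanti ht (lt_of_lt_of_le ht hT) hT

theorem sum_mul_log_nonneg (w l : ι → ℝ) (hl : ∀ i, 0 ≤ l i) (h0 : ∀ i, l i = 0 → w i = 0)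
    (hs : ∑ i, w i = 0) (hr : ∀ t : ℝ, 0 < t → ∑ i, w i * (l i + t)⁻¹ ≤ 0) :
    0 ≤ ∑ i, w i * Real.log (l i) := by
  have hlim : Tendsto (fun t : ℝ => ∑ i, w i * Real.log (l i + t)) (𝓝[>] 0)
      (𝓝 (∑ i, w i * Real.log (l i))) := by
    refine tendsto_finsetSum _ fun i _ => ?_
    by_cases h : l i = 0
    · simp [h0 i h]
    · have : Tendsto (fun t : ℝ => l i + t) (𝓝[>] 0) (𝓝 (l i)) := by
        have h2 : Tendsto (fun t : ℝ => l i + t) (𝓝 0) (𝓝 (l i + 0)) :=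
          tendsto_const_nhds.add tendsto_id
        rw [add_zero] at h2
        exact h2.mono_left nhdsWithin_le_nhds
      exact (this.log h).const_mul _
  refine ge_of_tendsto hlim ?_
  filter_upwards [self_mem_nhdsWithin] with t ht
  exact sum_mul_log_add_nonneg w l hl hs hr ht

end Scalar

/-! ### Spectral calculus, and traces of logarithms compared through resolvents. -/

section Spectral

variable {n : Type*} [Fintype n] [DecidableEq n] {A : Matrix n n ℂ}

/-- The diagonal entries of `K` in an eigenbasis of the Hermitian matrix `A`. -/
def spectralWeight (hA : A.IsHermitian) (K : Matrix n n ℂ) (i : n) : ℝ :=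
  (((hA.eigenvectorUnitary : Matrix n n ℂ)ᴴ * K * (hA.eigenvectorUnitary : Matrix n n ℂ)) i i).re

theorem cfc_eq_conj (hA : A.IsHermitian) (f : ℝ → ℝ) :
    cfc f A = (hA.eigenvectorUnitary : Matrix n n ℂ) *
      diagonal (fun i => (f (hA.eigenvalues i) : ℂ)) *
      (hA.eigenvectorUnitary : Matrix n n ℂ)ᴴ := by
  rw [hA.cfc_eq, Matrix.IsHermitian.cfc, Unitary.conjStarAlgAut_apply]
  rfl

theorem re_trace_mul_cfc (hA : A.IsHermitian) (K : Matrix n n ℂ) (f : ℝ → ℝ) :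
    (K * cfc f A).trace.re = ∑ i, spectralWeight hA K i * f (hA.eigenvalues i) := by
  rw [cfc_eq_conj hA, ← mul_assoc, ← mul_assoc, trace_mul_comm, ← mul_assoc, ← mul_assoc,
    trace, Complex.re_sum]
  refine Finset.sum_congr rfl fun i _ => ?_
  simp [spectralWeight, mul_diagonal]

theorem cfc_congr_eigenvalues (hA : A.IsHermitian) {f g : ℝ → ℝ}
    (h : ∀ i, f (hA.eigenvalues i) = g (hA.eigenvalues i)) : cfc f A = cfc g A := by
  simp only [cfc_eq_conj hA, h]

theorem cfc_id_matrix (hA : A.IsHermitian) : cfc (fun x : ℝ => x) A = A := by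
  conv_rhs => rw [hA.spectral_theorem, Unitary.conjStarAlgAut_apply]
  rw [cfc_eq_conj hA]
  rfl

theorem cfc_one_matrix (hA : A.IsHermitian) : cfc (fun _ : ℝ => (1 : ℝ)) A = 1 := by
  have hU : (hA.eigenvectorUnitary : Matrix n n ℂ) * (hA.eigenvectorUnitary : Matrix n n ℂ)ᴴ = 1 :=
    Unitary.coe_mul_star_self _
  rw [cfc_eq_conj hA]
  simp [hU]

theorem cfc_mul_matrix (hA : A.IsHermitian) (f g : ℝ → ℝ) :
    cfc f A * cfc g A = cfc (fun x => f x * g x) A := by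
  have hU : (hA.eigenvectorUnitary : Matrix n n ℂ)ᴴ * (hA.eigenvectorUnitary : Matrix n n ℂ) = 1 :=
    Unitary.coe_star_mul_self _
  simp only [cfc_eq_conj hA]
  calc _ = (hA.eigenvectorUnitary : Matrix n n ℂ) *
      diagonal (fun i => (f (hA.eigenvalues i) : ℂ)) *
      ((hA.eigenvectorUnitary : Matrix n n ℂ)ᴴ * (hA.eigenvectorUnitary : Matrix n n ℂ)) *
      diagonal (fun i => (g (hA.eigenvalues i) : ℂ)) *
      (hA.eigenvectorUnitary : Matrix n n ℂ)ᴴ := by simp only [mul_assoc]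
    _ = _ := by
      rw [hU, mul_one, mul_assoc (hA.eigenvectorUnitary : Matrix n n ℂ), diagonal_mul_diagonal]
      simp

theorem posSemidef_cfc (hA : A.IsHermitian) {f : ℝ → ℝ} (hf : ∀ i, 0 ≤ f (hA.eigenvalues i)) :
    (cfc f A).PosSemidef := by
  rw [cfc_eq_conj hA]
  refine PosSemidef.mul_mul_conjTranspose_same (PosSemidef.diagonal fun i => ?_) _
  simpa using hf i

theorem sum_spectralWeight (hA : A.IsHermitian) (K : Matrix n n ℂ) :
    ∑ i, spectralWeight hA K i = K.trace.re := by
  have h := re_trace_mul_cfc hA K (fun _ => 1)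
  rw [cfc_one_matrix hA] at h
  simpa using h.symm

theorem re_trace_mul_self (hA : A.IsHermitian) (K : Matrix n n ℂ) :
    (K * A).trace.re = ∑ i, spectralWeight hA K i * hA.eigenvalues i := by
  have h := re_trace_mul_cfc hA K (fun x => x)
  rwa [cfc_id_matrix hA] at h

theorem spectralWeight_nonneg (hA : A.IsHermitian) {K : Matrix n n ℂ} (hK : K.PosSemidef) (i : n) :
    0 ≤ spectralWeight hA K i :=
  (Complex.le_def.1 (hK.conjTranspose_mul_mul_same
    (hA.eigenvectorUnitary : Matrix n n ℂ)).diag_nonneg).1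

/-- This makes the convention log 0 = 0 harmless: zero eigenvalues carry no weight. -/
theorem spectralWeight_eq_zero (hA : A.IsHermitian) {K : Matrix n n ℂ}
    (hK : ∀ v, A *ᵥ v = 0 → K *ᵥ v = 0) {i : n} (hi : hA.eigenvalues i = 0) :
    spectralWeight hA K i = 0 := by
  have h1 : K *ᵥ ((hA.eigenvectorUnitary : Matrix n n ℂ) *ᵥ Pi.single i 1) = 0 := by
    apply hK
    rw [hA.eigenvectorUnitary_mulVec, hA.mulVec_eigenvectorBasis, hi, zero_smul]
  have h2 : ((hA.eigenvectorUnitary : Matrix n n ℂ)ᴴ * K *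
      (hA.eigenvectorUnitary : Matrix n n ℂ)) *ᵥ Pi.single i 1 = 0 := by
    rw [← mulVec_mulVec, ← mulVec_mulVec, h1, mulVec_zero]
  rw [mulVec_single_one] at h2
  have h3 := congrFun h2 i
  simp only [col_apply, Pi.zero_apply] at h3
  rw [spectralWeight, h3, Complex.zero_re]

theorem resolvent_eq_cfc (hA : A.PosSemidef) {t : ℝ} (ht : 0 < t) :
    (A + t • (1 : Matrix n n ℂ))⁻¹ = cfc (fun x : ℝ => (x + t)⁻¹) A := by
  apply inv_eq_left_inv
  have h1 : A + t • (1 : Matrix n n ℂ) = cfc (fun x : ℝ => x + t) A := by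
    have hU : (hA.1.eigenvectorUnitary : Matrix n n ℂ) *
        (hA.1.eigenvectorUnitary : Matrix n n ℂ)ᴴ = 1 := Unitary.coe_mul_star_self _
    have h2 := cfc_eq_conj hA.1 (fun x => x)
    rw [cfc_id_matrix hA.1] at h2
    rw [cfc_eq_conj hA.1]
    have h3 : diagonal (fun i => ((hA.1.eigenvalues i + t : ℝ) : ℂ)) =
      diagonal (fun i => ((hA.1.eigenvalues i : ℝ) : ℂ)) + t • (1 : Matrix n n ℂ) := by
      ext i j
      by_cases h : i = j <;> simp [h, diagonal, one_apply]
    rw [h3, mul_add, add_mul, ← h2, mul_smul_comm, mul_one, smul_mul_assoc, hU]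
  rw [h1, cfc_mul_matrix hA.1, ← cfc_one_matrix hA.1]
  refine cfc_congr_eigenvalues hA.1 fun i => ?_
  have := hA.eigenvalues_nonneg i
  exact inv_mul_cancel₀ (by positivity)

theorem posDef_add_smul_one {m : Type*} [DecidableEq m] {A : Matrix m m ℂ}
    (hA : A.PosSemidef) {t : ℝ} (ht : 0 < t) :
    (A + t • (1 : Matrix m m ℂ)).PosDef :=
  PosDef.posSemidef_add hA (PosDef.one.smul ht)

/-- Comparison of logarithmic traces from the comparison of the traces of the resolvents. -/
theorem re_trace_mul_logM_le {A A₁ A₂ K K₁ K₂ : Matrix n n ℂ} (p₁ p₂ : ℝ) (hA : A.PosSemidef)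
    (hA₁ : A₁.PosSemidef) (hA₂ : A₂.PosSemidef) (hK : ∀ v, A *ᵥ v = 0 → K *ᵥ v = 0)
    (hK₁ : ∀ v, A₁ *ᵥ v = 0 → K₁ *ᵥ v = 0) (hK₂ : ∀ v, A₂ *ᵥ v = 0 → K₂ *ᵥ v = 0)
    (htr : K.trace.re = p₁ * K₁.trace.re + p₂ * K₂.trace.re)
    (hres : ∀ t : ℝ, 0 < t → p₁ * (K₁ * (A₁ + t • (1 : Matrix n n ℂ))⁻¹).trace.re +
      p₂ * (K₂ * (A₂ + t • (1 : Matrix n n ℂ))⁻¹).trace.re ≤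
        (K * (A + t • (1 : Matrix n n ℂ))⁻¹).trace.re) :
    (K * logM A).trace.re ≤ p₁ * (K₁ * logM A₁).trace.re + p₂ * (K₂ * logM A₂).trace.re := by
  -- The three spectra are merged into one signed family, with total weight zero by `htr`; no common
  -- eigenbasis is needed.
  have h := sum_mul_log_nonneg (ι := n ⊕ n ⊕ n)
    (Sum.elim (fun i => -spectralWeight hA.1 K i) (Sum.elim
      (fun i => p₁ * spectralWeight hA₁.1 K₁ i) (fun i => p₂ * spectralWeight hA₂.1 K₂ i)))
    (Sum.elim hA.1.eigenvalues (Sum.elim hA₁.1.eigenvalues hA₂.1.eigenvalues)) ?_ ?_ ?_ ?_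
  · simp only [Fintype.sum_sum_type, Sum.elim_inl, Sum.elim_inr, neg_mul, Finset.sum_neg_distrib,
      mul_assoc, ← Finset.mul_sum] at h
    rw [logM, logM, logM, re_trace_mul_cfc hA.1, re_trace_mul_cfc hA₁.1, re_trace_mul_cfc hA₂.1]
    linarith
  · rintro (i | i | i)
    exacts [hA.eigenvalues_nonneg i, hA₁.eigenvalues_nonneg i, hA₂.eigenvalues_nonneg i]
  · rintro (i | i | i) hi
    · simp [spectralWeight_eq_zero hA.1 hK hi]
    · simp [spectralWeight_eq_zero hA₁.1 hK₁ hi]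
    · simp [spectralWeight_eq_zero hA₂.1 hK₂ hi]
  · simp only [Fintype.sum_sum_type, Sum.elim_inl, Sum.elim_inr, Finset.sum_neg_distrib,
      ← Finset.mul_sum, sum_spectralWeight]
    linarith
  · intro t ht
    have := hres t ht
    rw [resolvent_eq_cfc hA ht, resolvent_eq_cfc hA₁ ht, resolvent_eq_cfc hA₂ ht,
      re_trace_mul_cfc hA.1, re_trace_mul_cfc hA₁.1, re_trace_mul_cfc hA₂.1] at this
    simp only [Fintype.sum_sum_type, Sum.elim_inl, Sum.elim_inr, neg_mul, Finset.sum_neg_distrib,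
      mul_assoc, ← Finset.mul_sum]
    linarith

/-- The variational lower bound for the inverse of a positive definite matrix. -/
theorem re_trace_inv_ge {A : Matrix n n ℂ} (hA : A.PosDef) (M N : Matrix n n ℂ) :
    2 * (Nᴴ * M).trace.re - (Nᴴ * A * N).trace.re ≤ (Mᴴ * A⁻¹ * M).trace.re := by
  have hu := (isUnit_iff_isUnit_det A).1 hA.isUnit
  have h1 : A * A⁻¹ = 1 := mul_nonsing_inv A hu
  have h2 : A⁻¹ * A = 1 := nonsing_inv_mul A hu
  have hH : (A⁻¹)ᴴ = A⁻¹ := hA.inv.1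
  have h := (hA.posSemidef.conjTranspose_mul_mul_same (N - A⁻¹ * M)).trace_nonneg
  have h0 := (Complex.le_def.1 h).1
  have h3 : (N - A⁻¹ * M)ᴴ * A * (N - A⁻¹ * M) =
      Nᴴ * A * N - Nᴴ * M - Mᴴ * N + Mᴴ * A⁻¹ * M := by
    rw [conjTranspose_sub, conjTranspose_mul, hH]
    calc _ = Nᴴ * A * N - Nᴴ * (A * A⁻¹) * M - Mᴴ * (A⁻¹ * A) * N
        + Mᴴ * (A⁻¹ * A) * A⁻¹ * M := by noncomm_ring
      _ = _ := by rw [h1, h2]; simp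
  have h4 : (Mᴴ * N).trace.re = (Nᴴ * M).trace.re := by
    have : Mᴴ * N = (Nᴴ * M)ᴴ := by simp
    rw [this, trace_conjTranspose]
    simp
  rw [h3] at h0
  simp only [trace_add, trace_sub, Complex.add_re, Complex.sub_re, h4, Complex.zero_re] at h0
  linarith

theorem posSemidef_sqrtM (hA : A.PosSemidef) : (sqrtM A).PosSemidef :=
  posSemidef_cfc hA.1 fun _ => Real.sqrt_nonneg _

theorem sqrtM_mul_self (hA : A.PosSemidef) : sqrtM A * sqrtM A = A := by
  rw [sqrtM, cfc_mul_matrix hA.1]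
  conv_rhs => rw [← cfc_id_matrix hA.1]
  exact cfc_congr_eigenvalues hA.1 fun i => Real.mul_self_sqrt (hA.eigenvalues_nonneg i)

theorem conjTranspose_sqrtM (hA : A.PosSemidef) : (sqrtM A)ᴴ = sqrtM A :=
  (posSemidef_sqrtM hA).1

theorem posDef_sqrtM (hA : A.PosDef) : (sqrtM A).PosDef := by
  refine (posSemidef_sqrtM hA.posSemidef).posDef_iff_isUnit.2 ?_
  have h := hA.isUnit
  rw [← sqrtM_mul_self hA.posSemidef] at h
  exact isUnit_of_mul_isUnit_left h

/-- The variational bound for `A⁻¹` is tested at `B⁻¹ * M`, the optimal choice for `B`. -/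
theorem re_trace_mul_inv_anti {A B K : Matrix n n ℂ} (hA : A.PosDef) (hB : B.PosDef)
    (hAB : (B - A).PosSemidef) (hK : K.PosSemidef) :
    (K * B⁻¹).trace.re ≤ (K * A⁻¹).trace.re := by
  set M := sqrtM K
  have hM : M * M = K := sqrtM_mul_self hK
  have hMH : Mᴴ = M := conjTranspose_sqrtM hK
  have hcyc : ∀ C : Matrix n n ℂ, (K * C).trace = (Mᴴ * C * M).trace := fun C => by
    rw [hMH, mul_assoc M C M, trace_mul_comm M, mul_assoc, hM, trace_mul_comm]
  have hu := (isUnit_iff_isUnit_det B).1 hB.isUnit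
  have hH : (B⁻¹)ᴴ = B⁻¹ := hB.inv.1
  have h1 := re_trace_inv_ge hA M (B⁻¹ * M)
  have h2 := (Complex.le_def.1 (hAB.conjTranspose_mul_mul_same (B⁻¹ * M)).trace_nonneg).1
  rw [mul_sub, sub_mul, trace_sub, Complex.sub_re] at h2
  have h3 : (B⁻¹ * M)ᴴ * B * (B⁻¹ * M) = Mᴴ * B⁻¹ * M := by
    rw [conjTranspose_mul, hH]
    calc _ = Mᴴ * (B⁻¹ * B) * B⁻¹ * M := by noncomm_ring
      _ = _ := by rw [nonsing_inv_mul B hu, mul_one]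
  have h4 : (B⁻¹ * M)ᴴ * M = Mᴴ * B⁻¹ * M := by rw [conjTranspose_mul, hH]
  rw [h3, Complex.zero_re] at h2
  rw [h4] at h1
  rw [hcyc, hcyc]
  linarith

end Spectral

/-! ### Operator convexity of x log x and joint convexity of the relative trace. -/

section Convexity

theorem re_trace_conjTranspose_mul_comm {m : Type*} [Fintype m] (M N : Matrix m m ℂ) :
    (Mᴴ * N).trace.re = (Nᴴ * M).trace.re := by
  have : Mᴴ * N = (Nᴴ * M)ᴴ := by simp
  rw [this, trace_conjTranspose]
  simp

theorem re_trace_smul {m : Type*} [Fintype m] (c : ℝ) (M : Matrix m m ℂ) :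
    (c • M).trace.re = c * M.trace.re := by
  rw [trace_smul, Complex.smul_re, smul_eq_mul]

variable {n : Type*} [Fintype n] [DecidableEq n]

/-- The quadratic form whose minimum over `N` is `tr[M Mᴴ X (X + t)⁻¹]`. -/
def resolventForm (t : ℝ) (X M N : Matrix n n ℂ) : ℝ :=
  ((M - t • N)ᴴ * (M - t • N)).trace.re + t * (Nᴴ * X * N).trace.re

theorem resolventForm_eq (t : ℝ) (X M N : Matrix n n ℂ) :
    resolventForm t X M N = (Mᴴ * M).trace.re - t * (2 * (Nᴴ * M).trace.re -
      (Nᴴ * (X + t • (1 : Matrix n n ℂ)) * N).trace.re) := by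
  have h1 : (M - t • N)ᴴ * (M - t • N) =
      Mᴴ * M - t • (Mᴴ * N) - t • (Nᴴ * M) + (t * t) • (Nᴴ * N) := by
    rw [conjTranspose_sub, conjTranspose_smul, star_trivial, sub_mul, mul_sub, mul_sub,
      smul_mul_assoc, smul_mul_assoc, mul_smul_comm, mul_smul_comm, smul_smul]
    abel
  have h2 : Nᴴ * (X + t • (1 : Matrix n n ℂ)) * N = Nᴴ * X * N + t • (Nᴴ * N) := by
    rw [mul_add, add_mul, mul_smul_comm, mul_one, smul_mul_assoc]
  rw [resolventForm, h1, h2]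
  simp only [trace_add, trace_sub, Complex.add_re, Complex.sub_re, re_trace_smul]
  rw [re_trace_conjTranspose_mul_comm M N]
  ring

theorem mul_resolvent {X : Matrix n n ℂ} (hX : X.PosSemidef) {t : ℝ} (ht : 0 < t) :
    X * (X + t • (1 : Matrix n n ℂ))⁻¹ = 1 - t • (X + t • (1 : Matrix n n ℂ))⁻¹ := by
  have h := mul_nonsing_inv _ ((isUnit_iff_isUnit_det _).1 (posDef_add_smul_one hX ht).isUnit)
  rw [add_mul, smul_mul_assoc, one_mul] at h
  exact eq_sub_of_add_eq h

theorem re_trace_mul_resolvent {X : Matrix n n ℂ} (hX : X.PosSemidef) {t : ℝ} (ht : 0 < t)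
    (M : Matrix n n ℂ) :
    (M * Mᴴ * X * (X + t • (1 : Matrix n n ℂ))⁻¹).trace.re =
      (Mᴴ * M).trace.re - t * (Mᴴ * (X + t • (1 : Matrix n n ℂ))⁻¹ * M).trace.re := by
  rw [mul_assoc, mul_resolvent hX ht, mul_sub, mul_one, mul_smul_comm, trace_sub, Complex.sub_re,
    re_trace_smul, trace_mul_comm M, mul_assoc M, trace_mul_comm M]

theorem re_trace_mul_resolvent_le {X : Matrix n n ℂ} (hX : X.PosSemidef) {t : ℝ} (ht : 0 < t)
    (M N : Matrix n n ℂ) :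
    (M * Mᴴ * X * (X + t • (1 : Matrix n n ℂ))⁻¹).trace.re ≤ resolventForm t X M N := by
  rw [re_trace_mul_resolvent hX ht, resolventForm_eq]
  have := mul_le_mul_of_nonneg_left (re_trace_inv_ge (posDef_add_smul_one hX ht) M N) ht.le
  linarith

theorem resolventForm_inv {X : Matrix n n ℂ} (hX : X.PosSemidef) {t : ℝ} (ht : 0 < t)
    (M : Matrix n n ℂ) :
    resolventForm t X M ((X + t • (1 : Matrix n n ℂ))⁻¹ * M) =
      (M * Mᴴ * X * (X + t • (1 : Matrix n n ℂ))⁻¹).trace.re := by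
  have hP := posDef_add_smul_one hX ht
  have hH : ((X + t • (1 : Matrix n n ℂ))⁻¹)ᴴ = (X + t • (1 : Matrix n n ℂ))⁻¹ := hP.inv.1
  have hI := nonsing_inv_mul _ ((isUnit_iff_isUnit_det _).1 hP.isUnit)
  rw [re_trace_mul_resolvent hX ht, resolventForm_eq, conjTranspose_mul, hH]
  have : Mᴴ * (X + t • (1 : Matrix n n ℂ))⁻¹ * (X + t • (1 : Matrix n n ℂ)) *
      ((X + t • (1 : Matrix n n ℂ))⁻¹ * M) = Mᴴ * (X + t • (1 : Matrix n n ℂ))⁻¹ * M := by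
    rw [mul_assoc Mᴴ, hI, mul_one, mul_assoc]
  rw [this]
  ring

/-- Convexity of `tr[M Mᴴ X log X]` from the concavity of the resolvent forms. -/
theorem re_trace_mul_log_le_of_resolventForm {X X₁ X₂ M M₁ M₂ : Matrix n n ℂ} {p₁ p₂ : ℝ}
    (hp₁ : 0 ≤ p₁) (hp₂ : 0 ≤ p₂) (hX : X.PosSemidef) (hX₁ : X₁.PosSemidef)
    (hX₂ : X₂.PosSemidef)
    (htr : (M * Mᴴ * X).trace.re =
      p₁ * (M₁ * M₁ᴴ * X₁).trace.re + p₂ * (M₂ * M₂ᴴ * X₂).trace.re)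
    (hQ : ∀ t N, ∃ N₁ N₂, p₁ * resolventForm t X₁ M₁ N₁ + p₂ * resolventForm t X₂ M₂ N₂ ≤
      resolventForm t X M N) :
    (M * Mᴴ * X * logM X).trace.re ≤
      p₁ * (M₁ * M₁ᴴ * X₁ * logM X₁).trace.re + p₂ * (M₂ * M₂ᴴ * X₂ * logM X₂).trace.re := by
  refine re_trace_mul_logM_le p₁ p₂ hX hX₁ hX₂ ?_ ?_ ?_ htr fun t ht => ?_
  · intro v hv
    rw [← mulVec_mulVec, hv, mulVec_zero]
  · intro v hv
    rw [← mulVec_mulVec, hv, mulVec_zero]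
  · intro v hv
    rw [← mulVec_mulVec, hv, mulVec_zero]
  -- This is the minimiser for `X`; for `X₁` and `X₂` any trial matrices bound the resolvent trace
  -- from above, which is the direction needed.
  · obtain ⟨N₁, N₂, h⟩ := hQ t ((X + t • (1 : Matrix n n ℂ))⁻¹ * M)
    rw [resolventForm_inv hX ht] at h
    refine le_trans ?_ h
    gcongr
    · exact re_trace_mul_resolvent_le hX₁ ht M₁ N₁
    · exact re_trace_mul_resolvent_le hX₂ ht M₂ N₂

/-- Operator convexity of `x ↦ x log x`. -/
theorem re_trace_mul_log_convex {W X₁ X₂ : Matrix n n ℂ} (hW : W.PosSemidef) {p₁ p₂ : ℝ}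
    (hp₁ : 0 ≤ p₁) (hp₂ : 0 ≤ p₂) (hp : p₁ + p₂ = 1) (hX₁ : X₁.PosSemidef)
    (hX₂ : X₂.PosSemidef) :
    (W * (p₁ • X₁ + p₂ • X₂) * logM (p₁ • X₁ + p₂ • X₂)).trace.re ≤
      p₁ * (W * X₁ * logM X₁).trace.re + p₂ * (W * X₂ * logM X₂).trace.re := by
  have hM : sqrtM W * (sqrtM W)ᴴ = W := by rw [conjTranspose_sqrtM hW, sqrtM_mul_self hW]
  have h := re_trace_mul_log_le_of_resolventForm (X := p₁ • X₁ + p₂ • X₂) (M := sqrtM W)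
    (M₁ := sqrtM W) (M₂ := sqrtM W) hp₁ hp₂ ((hX₁.smul hp₁).add (hX₂.smul hp₂)) hX₁ hX₂ ?_ ?_
  · rwa [hM] at h
  · simp only [mul_add, mul_smul_comm, trace_add, Complex.add_re, re_trace_smul]
  · intro t N
    -- For fixed `M` and `N` the form is affine in `X`, so the same trial matrix serves both terms.
    refine ⟨N, N, le_of_eq ?_⟩
    simp only [resolventForm, mul_add, add_mul, mul_smul_comm, smul_mul_assoc, trace_add,
      Complex.add_re, re_trace_smul]
    linear_combination (((sqrtM W - t • N)ᴴ * (sqrtM W - t • N)).trace.re) * hp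

/-- The operator `γ^{-1/2} ω γ^{-1/2}`. -/
def relOp (ω γ : Matrix n n ℂ) : Matrix n n ℂ := (sqrtM γ)⁻¹ * ω * (sqrtM γ)⁻¹

/-- The trace `tr[γ X log X]` with `X = γ^{-1/2} ω γ^{-1/2}`. -/
def relTrace (ω γ : Matrix n n ℂ) : ℝ := (γ * relOp ω γ * logM (relOp ω γ)).trace.re

section

variable {γ : Matrix n n ℂ} (hγ : γ.PosDef) (ω : Matrix n n ℂ)
include hγ

theorem sqrtM_mul_inv : sqrtM γ * (sqrtM γ)⁻¹ = 1 :=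
  mul_nonsing_inv _ ((isUnit_iff_isUnit_det _).1 (posDef_sqrtM hγ).isUnit)

theorem inv_mul_sqrtM : (sqrtM γ)⁻¹ * sqrtM γ = 1 :=
  nonsing_inv_mul _ ((isUnit_iff_isUnit_det _).1 (posDef_sqrtM hγ).isUnit)

theorem conjTranspose_inv_sqrtM : ((sqrtM γ)⁻¹)ᴴ = (sqrtM γ)⁻¹ := (posDef_sqrtM hγ).inv.1

theorem inv_sqrtM_mul_self : (sqrtM γ)⁻¹ * (sqrtM γ)⁻¹ = γ⁻¹ := by
  rw [← Matrix.mul_inv_rev, sqrtM_mul_self hγ.posSemidef]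

theorem posSemidef_relOp {ω : Matrix n n ℂ} (hω : ω.PosSemidef) : (relOp ω γ).PosSemidef := by
  have h := hω.mul_mul_conjTranspose_same (sqrtM γ)⁻¹
  rwa [conjTranspose_inv_sqrtM hγ] at h

theorem sqrtM_mul_relOp_mul : sqrtM γ * relOp ω γ * sqrtM γ = ω := by
  calc _ = (sqrtM γ * (sqrtM γ)⁻¹) * ω * ((sqrtM γ)⁻¹ * sqrtM γ) := by
        rw [relOp]; noncomm_ring
    _ = ω := by rw [sqrtM_mul_inv hγ, inv_mul_sqrtM hγ, one_mul, mul_one]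

theorem trace_mul_relOp : (γ * relOp ω γ).trace = ω.trace := by
  conv_rhs => rw [← sqrtM_mul_relOp_mul hγ ω, trace_mul_comm, ← mul_assoc,
    sqrtM_mul_self hγ.posSemidef]

theorem trace_relOp : (relOp ω γ).trace = (ω * γ⁻¹).trace := by
  rw [relOp, trace_mul_comm, ← mul_assoc, inv_sqrtM_mul_self hγ, trace_mul_comm]

/-- The substitution N = γ^{1/2} Z removes all roots and inverses: for fixed `Z` the form is linear
in the pair (ω, γ). Its minimum over `Z` is hence jointly concave, which yields the joint convexity
of `relTrace`. -/
theorem resolventForm_relOp (t : ℝ) (Z : Matrix n n ℂ) :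
    resolventForm t (relOp ω γ) (sqrtM γ) (sqrtM γ * Z) =
      ((1 - t • Z)ᴴ * γ * (1 - t • Z)).trace.re + t * (Zᴴ * ω * Z).trace.re := by
  have hH := conjTranspose_sqrtM hγ.posSemidef
  have h1 : sqrtM γ - t • (sqrtM γ * Z) = sqrtM γ * (1 - t • Z) := by
    rw [mul_sub, mul_one, mul_smul_comm]
  have h2 : (sqrtM γ * (1 - t • Z))ᴴ * (sqrtM γ * (1 - t • Z)) = (1 - t • Z)ᴴ * γ * (1 - t • Z) := by
    conv_rhs => rw [← sqrtM_mul_self hγ.posSemidef]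
    rw [conjTranspose_mul, hH]
    simp only [mul_assoc]
  have h3 : (sqrtM γ * Z)ᴴ * relOp ω γ * (sqrtM γ * Z) = Zᴴ * ω * Z := by
    conv_rhs => rw [← sqrtM_mul_relOp_mul hγ ω]
    rw [conjTranspose_mul, hH]
    simp only [mul_assoc]
  rw [resolventForm, h1, h2, h3]

end

/-- Joint convexity of `relTrace`. -/
theorem relTrace_convex {ω₁ ω₂ γ₁ γ₂ : Matrix n n ℂ} (hω₁ : ω₁.PosSemidef) (hω₂ : ω₂.PosSemidef)
    (hγ₁ : γ₁.PosDef) (hγ₂ : γ₂.PosDef) {p₁ p₂ : ℝ} (hp₁ : 0 < p₁) (hp₂ : 0 ≤ p₂) :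
    relTrace (p₁ • ω₁ + p₂ • ω₂) (p₁ • γ₁ + p₂ • γ₂) ≤
      p₁ * relTrace ω₁ γ₁ + p₂ * relTrace ω₂ γ₂ := by
  have hω : (p₁ • ω₁ + p₂ • ω₂).PosSemidef := (hω₁.smul hp₁.le).add (hω₂.smul hp₂)
  have hγ : (p₁ • γ₁ + p₂ • γ₂).PosDef := (hγ₁.smul hp₁).add_posSemidef (hγ₂.posSemidef.smul hp₂)
  have hM : ∀ {γ : Matrix n n ℂ}, γ.PosDef → sqrtM γ * (sqrtM γ)ᴴ = γ := fun h => by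
    rw [conjTranspose_sqrtM h.posSemidef, sqrtM_mul_self h.posSemidef]
  have h := re_trace_mul_log_le_of_resolventForm (M := sqrtM (p₁ • γ₁ + p₂ • γ₂))
    (M₁ := sqrtM γ₁) (M₂ := sqrtM γ₂) hp₁.le hp₂ (posSemidef_relOp hγ hω)
    (posSemidef_relOp hγ₁ hω₁) (posSemidef_relOp hγ₂ hω₂) ?_ ?_
  · rwa [hM hγ, hM hγ₁, hM hγ₂] at h
  · rw [hM hγ, hM hγ₁, hM hγ₂, trace_mul_relOp hγ, trace_mul_relOp hγ₁, trace_mul_relOp hγ₂,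
      trace_add, Complex.add_re, re_trace_smul, re_trace_smul]
  · intro t N
    obtain ⟨Z, rfl⟩ : ∃ Z, N = sqrtM (p₁ • γ₁ + p₂ • γ₂) * Z :=
      ⟨(sqrtM (p₁ • γ₁ + p₂ • γ₂))⁻¹ * N, by rw [← mul_assoc, sqrtM_mul_inv hγ, one_mul]⟩
    refine ⟨sqrtM γ₁ * Z, sqrtM γ₂ * Z, le_of_eq ?_⟩
    rw [resolventForm_relOp hγ, resolventForm_relOp hγ₁, resolventForm_relOp hγ₂]
    simp only [mul_add, add_mul _ _ Z, add_mul _ _ (1 - t • Z), mul_smul_comm, smul_mul_assoc,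
      trace_add, Complex.add_re, re_trace_smul]
    ring

end Convexity

/-! ### Bounds on the relative trace and its almost concavity. -/

section Bounds

variable {n : Type*} [Fintype n] [DecidableEq n]

theorem cfc_smul_matrix {A : Matrix n n ℂ} (hA : A.IsHermitian) (c : ℝ) (f : ℝ → ℝ) :
    cfc f (c • A) = cfc (fun x : ℝ => f (c * x)) A :=
  (cfc_comp_const_mul c f A ((finite_real_spectrum.image _).continuousOn _) hA).symm

theorem re_trace_mul_logM_smul {A K : Matrix n n ℂ} (hA : A.IsHermitian)
    (hK : ∀ v, A *ᵥ v = 0 → K *ᵥ v = 0) {c : ℝ} (hc : 0 < c) :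
    (K * logM (c • A)).trace.re = (K * logM A).trace.re + Real.log c * K.trace.re := by
  rw [logM, logM, cfc_smul_matrix hA, re_trace_mul_cfc hA, re_trace_mul_cfc hA,
    ← sum_spectralWeight hA, Finset.mul_sum, ← Finset.sum_add_distrib]
  refine Finset.sum_congr rfl fun i _ => ?_
  by_cases h : hA.eigenvalues i = 0
  · simp [spectralWeight_eq_zero hA hK h]
  · rw [Real.log_mul hc.ne' h]
    ring

theorem mul_mulVec_eq_zero {m : Type*} [Fintype m] (K : Matrix m m ℂ) {A : Matrix m m ℂ} (v : m → ℂ)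
    (hv : A *ᵥ v = 0) :
    (K * A) *ᵥ v = 0 := by
  rw [← mulVec_mulVec, hv, mulVec_zero]

theorem re_trace_mul_self_mul_logM {A : Matrix n n ℂ} (hA : A.IsHermitian) (K : Matrix n n ℂ) :
    (K * A * logM A).trace.re = ∑ i, spectralWeight hA K i *
      (hA.eigenvalues i * Real.log (hA.eigenvalues i)) := by
  have : A * logM A = cfc (fun x : ℝ => x * Real.log x) A := by
    conv_lhs => enter [1]; rw [← cfc_id_matrix hA]
    rw [logM, cfc_mul_matrix hA]
  rw [mul_assoc, this, re_trace_mul_cfc hA]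

theorem spectralWeight_self {A : Matrix n n ℂ} (hA : A.IsHermitian) (i : n) :
    spectralWeight hA A i = hA.eigenvalues i := by
  have h := hA.conjStarAlgAut_star_eigenvectorUnitary
  rw [Unitary.conjStarAlgAut_star_apply] at h
  have h2 := congrFun (congrFun h i) i
  simp only [diagonal_apply_eq, Function.comp_apply] at h2
  exact (congrArg Complex.re h2).trans (Complex.ofReal_re _)

theorem eigenvalues_le_of_posSemidef {A : Matrix n n ℂ} (hA : A.IsHermitian) {k : ℝ}
    (h : (k • (1 : Matrix n n ℂ) - A).PosSemidef) (i : n) : hA.eigenvalues i ≤ k := by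
  have hU : (hA.eigenvectorUnitary : Matrix n n ℂ)ᴴ * (hA.eigenvectorUnitary : Matrix n n ℂ) = 1 :=
    Unitary.coe_star_mul_self _
  have h1 := spectralWeight_nonneg hA h i
  have h2 : spectralWeight hA (k • (1 : Matrix n n ℂ) - A) i = k - hA.eigenvalues i := by
    rw [← spectralWeight_self hA i]
    simp [spectralWeight, mul_sub, sub_mul, hU]
  linarith

theorem posSemidef_one_sub {A : Matrix n n ℂ} (hA : A.PosSemidef) (htr : A.trace.re ≤ 1) :
    (1 - A).PosSemidef := by
  have h1 : 1 - A = cfc (fun x : ℝ => 1 - x) A := by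
    have h2 := cfc_id_matrix hA.1
    have h3 := cfc_one_matrix hA.1
    rw [cfc_eq_conj hA.1] at h2 h3 ⊢
    conv_lhs => rw [← h2, ← h3, ← sub_mul, ← mul_sub, diagonal_sub]
    simp
  rw [h1]
  refine posSemidef_cfc hA.1 fun i => ?_
  have h2 : A.trace.re = ∑ i, hA.1.eigenvalues i := by
    rw [hA.1.trace_eq_sum_eigenvalues, Complex.re_sum]
    rfl
  have h3 := Finset.single_le_sum (f := hA.1.eigenvalues)
    (fun i _ => hA.eigenvalues_nonneg i) (Finset.mem_univ i)
  linarith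

/-- Klein-type argument: x log x ≥ x - 1, and tr[γ (X - 1)] = tr ω - tr γ. -/
theorem relTrace_nonneg {ω γ : Matrix n n ℂ} (hω : ω.PosSemidef) (hγ : γ.PosDef)
    (htr : γ.trace.re ≤ ω.trace.re) : 0 ≤ relTrace ω γ := by
  have hX := posSemidef_relOp hγ hω
  have h1 : ∑ i, spectralWeight hX.1 γ i * (hX.1.eigenvalues i - 1) = ω.trace.re - γ.trace.re := by
    simp only [mul_sub, mul_one, Finset.sum_sub_distrib]
    rw [sum_spectralWeight, ← re_trace_mul_self, trace_mul_relOp hγ]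
  rw [relTrace, re_trace_mul_self_mul_logM hX.1]
  refine le_trans ?_ (Finset.sum_le_sum fun i _ => mul_le_mul_of_nonneg_left
    (a := spectralWeight hX.1 γ i) (?_ : hX.1.eigenvalues i - 1 ≤ _)
    (spectralWeight_nonneg hX.1 hγ.posSemidef i))
  · rw [h1]
    linarith
  · rcases (hX.eigenvalues_nonneg i).eq_or_lt with h | h
    · rw [← h]
      norm_num
    · have h2 := mul_le_mul_of_nonneg_left (Real.one_sub_inv_le_log_of_pos h) h.le
      rwa [mul_sub, mul_one, mul_inv_cancel₀ h.ne'] at h2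

/-- Conjugating ω ≤ kγ by γ^{-1/2} gives X ≤ k, so x log x ≤ x log k on the spectrum. -/
theorem relTrace_le_log {ω γ : Matrix n n ℂ} (hω : ω.PosSemidef) (hγ : γ.PosDef) {k : ℝ}
    (h : (k • γ - ω).PosSemidef) : relTrace ω γ ≤ Real.log k * ω.trace.re := by
  have hX := posSemidef_relOp hγ hω
  have hk : (k • (1 : Matrix n n ℂ) - relOp ω γ).PosSemidef := by
    have h1 := h.mul_mul_conjTranspose_same (sqrtM γ)⁻¹
    have h2 : (sqrtM γ)⁻¹ * γ * (sqrtM γ)⁻¹ = 1 := by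
      conv_lhs => enter [1, 2]; rw [← sqrtM_mul_self hγ.posSemidef]
      rw [← mul_assoc, inv_mul_sqrtM hγ, one_mul, sqrtM_mul_inv hγ]
    rwa [conjTranspose_inv_sqrtM hγ, mul_sub, sub_mul, mul_smul_comm, smul_mul_assoc, h2] at h1
  have h1 : Real.log k * ω.trace.re =
      ∑ i, spectralWeight hX.1 γ i * (hX.1.eigenvalues i * Real.log k) := by
    rw [← trace_mul_relOp hγ, re_trace_mul_self hX.1, Finset.mul_sum]
    exact Finset.sum_congr rfl fun i _ => by ring
  rw [relTrace, re_trace_mul_self_mul_logM hX.1, h1]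
  refine Finset.sum_le_sum fun i _ => mul_le_mul_of_nonneg_left ?_
    (spectralWeight_nonneg hX.1 hγ.posSemidef i)
  rcases (hX.eigenvalues_nonneg i).eq_or_lt with h | h
  · simp [← h]
  · gcongr
    exact eigenvalues_le_of_posSemidef hX.1 hk i

theorem mulVec_eq_zero_of_add {m : Type*} [Fintype m] {A B : Matrix m m ℂ}
    (hA : A.PosSemidef) (hB : B.PosSemidef) {v : m → ℂ} (hv : (A + B) *ᵥ v = 0) : A *ᵥ v = 0 := by
  refine (hA.dotProduct_mulVec_zero_iff v).1 ?_
  have h1 := hA.dotProduct_mulVec_nonneg v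
  have h2 := hB.dotProduct_mulVec_nonneg v
  have h3 : star v ⬝ᵥ A *ᵥ v + star v ⬝ᵥ B *ᵥ v = 0 := by
    rw [← dotProduct_add, ← add_mulVec, hv, dotProduct_zero]
  exact ((add_eq_zero_iff_of_nonneg h1 h2).1 h3).1

/-- Monotonicity of the logarithm, tested against the smaller operator. -/
theorem re_trace_mul_logM_le_add {A B : Matrix n n ℂ} (hA : A.PosSemidef) (hB : B.PosSemidef) :
    (A * logM A).trace.re ≤ (A * logM (A + B)).trace.re := by
  have h := re_trace_mul_logM_le (A := A) (K := A) (A₁ := A + B) (K₁ := A) (A₂ := A) (K₂ := A) 1 0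
    hA (hA.add hB) hA (fun v hv => hv) (fun v hv => mulVec_eq_zero_of_add hA hB hv)
    (fun v hv => hv) (by ring) (fun t ht => ?_)
  · linarith
  · have h1 := re_trace_mul_inv_anti (K := A) (posDef_add_smul_one hA ht)
      (posDef_add_smul_one (hA.add hB) ht) (by simpa [add_sub_add_right_eq_sub] using hB) hA
    linarith

theorem re_trace_log_add_ge {A B : Matrix n n ℂ} (hA : A.PosSemidef) (hB : B.PosSemidef) :
    (A * logM A).trace.re + (B * logM B).trace.re ≤ ((A + B) * logM (A + B)).trace.re := by
  have h1 := re_trace_mul_logM_le_add hA hB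
  have h2 := re_trace_mul_logM_le_add hB hA
  rw [add_comm B A] at h2
  rw [add_mul, trace_add, Complex.add_re]
  linarith

theorem re_trace_smul_mul_logM_smul {A : Matrix n n ℂ} (hA : A.PosSemidef) {c : ℝ} (hc : 0 < c) :
    ((c • A) * logM (c • A)).trace.re =
      c * (A * logM A).trace.re + c * Real.log c * A.trace.re := by
  rw [smul_mul_assoc, re_trace_smul, re_trace_mul_logM_smul hA.1 (fun v hv => hv) hc]
  ring

theorem relOp_add_smul (ω₁ ω₂ γ : Matrix n n ℂ) (p₁ p₂ : ℝ) :
    relOp (p₁ • ω₁ + p₂ • ω₂) γ = p₁ • relOp ω₁ γ + p₂ • relOp ω₂ γ := by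
  simp only [relOp, mul_add, add_mul, mul_smul_comm, smul_mul_assoc]

/-- Almost concavity of `relTrace` in its first argument. -/
theorem relTrace_almost_concave {ω₁ ω₂ γ : Matrix n n ℂ} (hω₁ : ω₁ ∈ states n)
    (hω₂ : ω₂ ∈ states n) (hγ : γ.PosDef) (hγ1 : γ.trace.re ≤ 1) {p : ℝ} (hp0 : 0 < p)
    (hp1 : p < 1) {δ : ℝ} (hδ : 0 < δ) (hγδ : (γ - δ • (1 : Matrix n n ℂ)).PosSemidef) :
    p * relTrace ω₁ γ + (1 - p) * relTrace ω₂ γ - δ⁻¹ * Real.binEntropy p ≤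
      relTrace (p • ω₁ + (1 - p) • ω₂) γ := by
  have hq0 : 0 < 1 - p := by linarith
  have hX₁ := posSemidef_relOp hγ hω₁.1
  have hX₂ := posSemidef_relOp hγ hω₂.1
  have hW := posSemidef_one_sub hγ.posSemidef hγ1
  have htr : ∀ {ω : Matrix n n ℂ}, ω ∈ states n → (relOp ω γ).trace.re ≤ δ⁻¹ := by
    intro ω hω
    have h1 := re_trace_mul_inv_anti (K := ω) (PosDef.one.smul hδ) hγ hγδ hω.1
    have h2 : (δ • (1 : Matrix n n ℂ))⁻¹ = δ⁻¹ • (1 : Matrix n n ℂ) := by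
      apply inv_eq_left_inv
      rw [smul_mul_smul_comm, inv_mul_cancel₀ hδ.ne', one_mul, one_smul]
    rw [h2, mul_smul_comm, mul_one, re_trace_smul, hω.2, Complex.one_re, mul_one] at h1
    rwa [trace_relOp hγ]
  -- Convexity against the weight 1 - γ bounds the subtracted term from above; superadditivity
  -- bounds tr[X log X] from below. The scalars p log p and (1 - p) log(1 - p) appear multiplied by
  -- tr X₁ and tr X₂, which `htr` bounds by `δ⁻¹`.
  have hconv := re_trace_mul_log_convex hW hp0.le hq0.le (by ring) hX₁ hX₂
  have hsup := re_trace_log_add_ge (hX₁.smul hp0.le) (hX₂.smul hq0.le)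
  rw [re_trace_smul_mul_logM_smul hX₁ hp0, re_trace_smul_mul_logM_smul hX₂ hq0] at hsup
  have hsplit : ∀ X : Matrix n n ℂ, ((1 - γ) * X * logM X).trace.re =
      (X * logM X).trace.re - (γ * X * logM X).trace.re := fun X => by
    rw [sub_mul, sub_mul, one_mul, trace_sub, Complex.sub_re]
  rw [hsplit, hsplit, hsplit] at hconv
  have hl1 : p * Real.log p ≤ 0 :=
    mul_nonpos_of_nonneg_of_nonpos hp0.le (Real.log_nonpos hp0.le hp1.le)
  have hl2 : (1 - p) * Real.log (1 - p) ≤ 0 :=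
    mul_nonpos_of_nonneg_of_nonpos hq0.le (Real.log_nonpos hq0.le (by linarith))
  have h1 := mul_le_mul_of_nonpos_left (htr hω₁) hl1
  have h2 := mul_le_mul_of_nonpos_left (htr hω₂) hl2
  have hent : Real.binEntropy p = -(p * Real.log p) - (1 - p) * Real.log (1 - p) := by
    rw [Real.binEntropy, Real.log_inv, Real.log_inv]
    ring
  rw [relTrace, relTrace, relTrace, relOp_add_smul, hent]
  linarith

end Bounds

/-! ### The entropy as a relative trace, and full-rank replacements of the second argument. -/

section Entropy

variable {n : Type*} [Fintype n] [DecidableEq n]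

theorem pinvM_eq_inv {γ : Matrix n n ℂ} (hγ : γ.PosDef) : pinvM γ = γ⁻¹ := by
  refine (inv_eq_left_inv ?_).symm
  rw [pinvM]
  conv_lhs => enter [2]; rw [← cfc_id_matrix hγ.1]
  rw [cfc_mul_matrix hγ.1, ← cfc_one_matrix hγ.1]
  exact cfc_congr_eigenvalues hγ.1 fun i => inv_mul_cancel₀ (hγ.eigenvalues_pos i).ne'

theorem sqrtM_mulVec_eq_zero {ω : Matrix n n ℂ} (hω : ω.PosSemidef) {v : n → ℂ}
    (h : sqrtM ω *ᵥ v = 0) : ω *ᵥ v = 0 := by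
  rw [← sqrtM_mul_self hω]
  exact mul_mulVec_eq_zero _ v h

/-- With Y = γ^{-1/2} ω^{1/2} the two logarithms are those of YᴴY and YYᴴ, whose resolvents are
intertwined by Yᴴ. Equal resolvent traces give an inequality in each direction. -/
theorem re_trace_logM_eq_relTrace {ω γ : Matrix n n ℂ} (hω : ω.PosSemidef) (hγ : γ.PosDef) :
    (ω * logM (sqrtM ω * γ⁻¹ * sqrtM ω)).trace.re = relTrace ω γ := by
  set R := sqrtM ω with hR
  set G := sqrtM γ with hG
  set Y := G⁻¹ * R with hY
  have hRH : Rᴴ = R := conjTranspose_sqrtM hω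
  have hGH : (G⁻¹)ᴴ = G⁻¹ := conjTranspose_inv_sqrtM hγ
  have hRR : R * R = ω := sqrtM_mul_self hω
  have hGY : G * Y = R := by rw [hY, ← mul_assoc, sqrtM_mul_inv hγ, one_mul]
  have hYH : Yᴴ = R * G⁻¹ := by rw [hY, conjTranspose_mul, hGH, hRH]
  have hYG : Yᴴ * G = R := by rw [hYH, mul_assoc, inv_mul_sqrtM hγ, mul_one]
  have hA : R * γ⁻¹ * R = Yᴴ * Y := by
    rw [hYH, hY, ← inv_sqrtM_mul_self hγ]
    noncomm_ring
  have hX : relOp ω γ = Y * Yᴴ := by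
    rw [relOp, hYH, hY, ← hRR]
    noncomm_ring
  have hApos := posSemidef_conjTranspose_mul_self Y
  have hXpos := posSemidef_self_mul_conjTranspose Y
  have hker : ∀ v, (Yᴴ * Y) *ᵥ v = 0 → ω *ᵥ v = 0 := by
    intro v hv
    rw [conjTranspose_mul_self_mulVec_eq_zero] at hv
    apply sqrtM_mulVec_eq_zero hω
    rw [← hR, ← hGY]
    exact mul_mulVec_eq_zero _ v hv
  have htr : ω.trace.re = (γ * (Y * Yᴴ)).trace.re := by rw [← hX, trace_mul_relOp hγ]
  have hres : ∀ t : ℝ, 0 < t → (ω * (Yᴴ * Y + t • (1 : Matrix n n ℂ))⁻¹).trace.re =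
      (γ * (Y * Yᴴ) * (Y * Yᴴ + t • (1 : Matrix n n ℂ))⁻¹).trace.re := by
    intro t ht
    have hu1 := (isUnit_iff_isUnit_det _).1 (posDef_add_smul_one hApos ht).isUnit
    have hu2 := (isUnit_iff_isUnit_det _).1 (posDef_add_smul_one hXpos ht).isUnit
    set S := (Yᴴ * Y + t • (1 : Matrix n n ℂ))⁻¹ with hS
    set T := (Y * Yᴴ + t • (1 : Matrix n n ℂ))⁻¹ with hT
    have hpush : S * Yᴴ = Yᴴ * T := by
      have h1 : Yᴴ * (Y * Yᴴ + t • (1 : Matrix n n ℂ)) =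
          (Yᴴ * Y + t • (1 : Matrix n n ℂ)) * Yᴴ := by
        rw [mul_add, add_mul, mul_smul_comm, smul_mul_assoc, mul_one, one_mul, ← mul_assoc Yᴴ Y Yᴴ]
      calc S * Yᴴ = S * (Yᴴ * (Y * Yᴴ + t • (1 : Matrix n n ℂ)) * T) := by
            rw [mul_assoc Yᴴ, mul_nonsing_inv _ hu2, mul_one]
        _ = S * (Yᴴ * Y + t • (1 : Matrix n n ℂ)) * (Yᴴ * T) := by
            rw [h1]
            simp only [mul_assoc]
        _ = Yᴴ * T := by rw [nonsing_inv_mul _ hu1, one_mul]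
    have h2 : ω * S = (Yᴴ * G) * (G * Y) * S := by rw [hYG, hGY, hRR]
    have h3 : G * G = γ := sqrtM_mul_self hγ.posSemidef
    have h4 : (ω * S).trace = (γ * (Y * Yᴴ) * T).trace := by
      calc (ω * S).trace = (Yᴴ * (G * G * Y * S)).trace := by
            rw [h2]
            simp only [mul_assoc]
        _ = (γ * Y * (S * Yᴴ)).trace := by
            rw [trace_mul_comm, h3]
            simp only [mul_assoc]
        _ = _ := by
            rw [hpush]
            simp only [mul_assoc]
    rw [h4]
  rw [hA, relTrace, hX]
  apply le_antisymm
  · have h := re_trace_mul_logM_le (A := Yᴴ * Y) (K := ω) (A₁ := Y * Yᴴ) (K₁ := γ * (Y * Yᴴ))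
      (A₂ := Yᴴ * Y) (K₂ := ω) 1 0 hApos hXpos hApos hker (mul_mulVec_eq_zero γ) hker
      (by rw [htr]; ring) (fun t ht => by rw [hres t ht]; linarith)
    linarith
  · have h := re_trace_mul_logM_le (A₁ := Yᴴ * Y) (K₁ := ω) (A := Y * Yᴴ) (K := γ * (Y * Yᴴ))
      (A₂ := Yᴴ * Y) (K₂ := ω) 1 0 hXpos hApos hApos (mul_mulVec_eq_zero γ) hker hker
      (by rw [htr]; ring) (fun t ht => by rw [hres t ht]; linarith)
    linarith

theorem bsEntropy_eq_relTrace {ω γ : Matrix n n ℂ} (hω : ω.PosSemidef) (hγ : γ.PosDef) :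
    bsEntropy ω γ = (relTrace ω γ : EReal) := by
  have hker : LinearMap.ker γ.mulVecLin ≤ LinearMap.ker ω.mulVecLin := by
    intro v hv
    have h1 : γ *ᵥ v = 0 := hv
    have h2 : v = 0 := by
      have h3 := congrArg (γ⁻¹ *ᵥ ·) h1
      simpa [nonsing_inv_mul _ ((isUnit_iff_isUnit_det _).1 hγ.isUnit)] using h3
    simp [h2]
  rw [bsEntropy, if_pos hker, pinvM_eq_inv hγ, re_trace_logM_eq_relTrace hω hγ]

/-- Comparison of the entropy relative to `γ` with the one relative to a full-rank `γ' ≥ c γ`. -/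
theorem relTrace_le_of_smul_le {ω γ γ' : Matrix n n ℂ} (hω : ω.PosSemidef) (hγ : γ.PosSemidef)
    (hker : LinearMap.ker γ.mulVecLin ≤ LinearMap.ker ω.mulVecLin) (hγ' : γ'.PosDef) {c : ℝ}
    (hc : 0 < c) (hle : (γ' - c • γ).PosSemidef) :
    relTrace ω γ' ≤ (ω * logM (sqrtM ω * pinvM γ * sqrtM ω)).trace.re -
      Real.log c * ω.trace.re := by
  set R := sqrtM ω with hR
  set P := pinvM γ * R with hP
  have hRH : Rᴴ = R := conjTranspose_sqrtM hω
  have hRR : R * R = ω := sqrtM_mul_self hω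
  have hγp : (pinvM γ).PosSemidef :=
    posSemidef_cfc hγ.1 fun i => inv_nonneg.2 (hγ.eigenvalues_nonneg i)
  have hPH : Pᴴ = R * pinvM γ := by rw [hP, conjTranspose_mul, hRH, hγp.1]
  have hγγ : γ * pinvM γ * γ = γ := by
    have h := cfc_id_matrix hγ.1
    conv_lhs => rw [← h]
    rw [cfc_id_matrix hγ.1, pinvM]
    conv_lhs => enter [1, 1]; rw [← h]
    conv_lhs => enter [2]; rw [← h]
    rw [cfc_mul_matrix hγ.1, cfc_mul_matrix hγ.1]
    conv_rhs => rw [← h]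
    refine cfc_congr_eigenvalues hγ.1 fun i => ?_
    exact mul_inv_mul_cancel _
  -- The kernel condition enters here: 1 - γ⁺γ projects onto ker γ, hence is annihilated by ω and by
  -- its root; then take adjoints.
  have hγP : γ * P = R := by
    have h1 : γ * (1 - pinvM γ * γ) = 0 := by
      rw [mul_sub, mul_one, ← mul_assoc, hγγ, sub_self]
    have h2 : ω * (1 - pinvM γ * γ) = 0 := by
      ext i j
      have h3 : γ *ᵥ (1 - pinvM γ * γ).col j = 0 := by
        have := congrArg (fun M => M.col j) h1
        ext i
        exact congrFun this i
      exact congrFun (hker h3) i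
    have h3 : R * (1 - pinvM γ * γ) = 0 := by
      rw [← conjTranspose_mul_self_mul_eq_zero, hRH, hRR, h2]
    have h4 := congrArg conjTranspose h3
    rw [conjTranspose_mul, conjTranspose_sub, conjTranspose_mul, hRH, hγp.1, hγ.1,
      conjTranspose_one, conjTranspose_zero, sub_mul, one_mul, sub_eq_zero] at h4
    rw [hP, ← mul_assoc, ← h4]
  set T := γ'⁻¹ * R with hT
  have hu := (isUnit_iff_isUnit_det _).1 hγ'.isUnit
  have hTH : Tᴴ = R * γ'⁻¹ := by rw [hT, conjTranspose_mul, hRH, hγ'.inv.1]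
  set A := R * γ'⁻¹ * R with hA
  set B := R * pinvM γ * R with hB
  have hApos : A.PosSemidef := by
    have := hγ'.inv.posSemidef.mul_mul_conjTranspose_same R
    rwa [hRH] at this
  have hBpos : B.PosSemidef := by
    have := hγp.mul_mul_conjTranspose_same R
    rwa [hRH] at this
  have hPγ : Pᴴ * γ = R := by
    have := congrArg conjTranspose hγP
    rwa [conjTranspose_mul, hγ.1, hRH] at this
  -- Antitonicity of the inverse for a possibly singular γ: the difference is a completed square in
  -- cγ plus a conjugate of γ' - cγ, using only γP = R.
  have hBA : (c⁻¹ • B - A).PosSemidef := by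
    have h1 := ((hγ.smul hc.le).conjTranspose_mul_mul_same (T - c⁻¹ • P)).add
      (hle.conjTranspose_mul_mul_same T)
    have e1 : Tᴴ * γ * P = A := by rw [mul_assoc, hγP, hTH]
    have e2 : Pᴴ * γ * T = A := by rw [hPγ, hT, hA, mul_assoc]
    have e3 : Pᴴ * γ * P = B := by rw [mul_assoc, hγP, hPH]
    have e4 : Tᴴ * γ' * T = A := by
      rw [hTH, hT, mul_assoc R, nonsing_inv_mul _ hu, mul_one, hA, mul_assoc]
    have h2 : (T - c⁻¹ • P)ᴴ * (c • γ) * (T - c⁻¹ • P) + Tᴴ * (γ' - c • γ) * T = c⁻¹ • B - A := by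
      rw [conjTranspose_sub, conjTranspose_smul, star_trivial]
      simp only [mul_sub, sub_mul, mul_smul_comm, smul_mul_assoc, e1, e2, e3, e4, smul_sub,
        smul_smul, mul_inv_cancel₀ hc.ne', one_smul]
      rw [inv_mul_cancel₀ hc.ne', one_smul]
      abel
    rwa [h2] at h1
  have hkerA : ∀ v, A *ᵥ v = 0 → ω *ᵥ v = 0 := by
    intro v hv
    have h1 : A = Tᴴ * γ' * T := by
      rw [hTH, hT, mul_assoc R, nonsing_inv_mul _ hu, mul_one, hA, mul_assoc]
    have h2 : star (T *ᵥ v) ⬝ᵥ γ' *ᵥ (T *ᵥ v) = 0 := by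
      rw [star_mulVec, ← dotProduct_mulVec, mulVec_mulVec, mulVec_mulVec, ← h1, hv,
        dotProduct_zero]
    have h3 := (hγ'.posSemidef.dotProduct_mulVec_zero_iff _).1 h2
    rw [mulVec_mulVec, hT, ← mul_assoc, mul_nonsing_inv _ hu, one_mul] at h3
    exact sqrtM_mulVec_eq_zero hω h3
  have hkerB : ∀ v, B *ᵥ v = 0 → ω *ᵥ v = 0 := by
    intro v hv
    have h1 : Pᴴ * γ * P = B := by rw [mul_assoc, hγP, hPH]
    have h2 : star (P *ᵥ v) ⬝ᵥ γ *ᵥ (P *ᵥ v) = 0 := by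
      rw [star_mulVec, ← dotProduct_mulVec, mulVec_mulVec, mulVec_mulVec, h1, hv,
        dotProduct_zero]
    have h3 := (hγ.dotProduct_mulVec_zero_iff _).1 h2
    rw [mulVec_mulVec, hγP] at h3
    exact sqrtM_mulVec_eq_zero hω h3
  have hci : 0 < c⁻¹ := inv_pos.2 hc
  have hkerB' : ∀ v, (c⁻¹ • B) *ᵥ v = 0 → ω *ᵥ v = 0 := by
    intro v hv
    rw [smul_mulVec] at hv
    exact hkerB v ((smul_eq_zero.1 hv).resolve_left hci.ne')
  have h := re_trace_mul_logM_le (A := A) (K := ω) (A₁ := c⁻¹ • B) (K₁ := ω) (A₂ := A) (K₂ := ω)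
    1 0 hApos (hBpos.smul hci.le) hApos hkerA hkerB' hkerA (by ring) (fun t ht => ?_)
  · rw [re_trace_mul_logM_smul hBpos.1 hkerB hci, Real.log_inv,
      re_trace_logM_eq_relTrace hω hγ'] at h
    linarith
  · have h1 := re_trace_mul_inv_anti (K := ω) (posDef_add_smul_one hApos ht)
      (posDef_add_smul_one (hBpos.smul hci.le) ht)
      (by simpa [add_sub_add_right_eq_sub] using hBA) hω
    linarith

end Entropy

/-! ### Trace distance and common mixtures. -/

section TraceNorm

theorem mem_states_of_re {m : Type*} [Fintype m] {A : Matrix m m ℂ} (hA : A.PosSemidef)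
    (h : A.trace.re = 1) :
    A ∈ states m := by
  refine ⟨hA, Complex.ext h ?_⟩
  rw [← (Complex.le_def.1 hA.trace_nonneg).2]
  simp

theorem re_trace_of_mem_states {m : Type*} [Fintype m] {A : Matrix m m ℂ} (hA : A ∈ states m) :
    A.trace.re = 1 := by
  rw [hA.2, Complex.one_re]

theorem eq_zero_of_re_trace {m : Type*} [Fintype m] {A : Matrix m m ℂ} (hA : A.PosSemidef)
    (h : A.trace.re ≤ 0) :
    A = 0 := by
  rw [← hA.trace_eq_zero_iff]
  have h1 := Complex.le_def.1 hA.trace_nonneg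
  exact Complex.ext (le_antisymm h h1.1) h1.2.symm

variable {n : Type*} [Fintype n] [DecidableEq n]

theorem cfc_comp_matrix {A : Matrix n n ℂ} (hA : A.IsHermitian) (f g : ℝ → ℝ) :
    cfc g (cfc f A) = cfc (fun x => g (f x)) A :=
  (cfc_comp g f A hA ((finite_real_spectrum.image _).continuousOn _)
    (finite_real_spectrum.continuousOn _)).symm

/-- The Jordan decomposition of a Hermitian matrix. -/
theorem exists_jordan_decomposition {H : Matrix n n ℂ} (hH : H.IsHermitian) :
    ∃ P N : Matrix n n ℂ, P.PosSemidef ∧ N.PosSemidef ∧ H = P - N ∧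
      P.trace.re + N.trace.re = traceNorm H := by
  have hid := cfc_id_matrix hH
  have hone : ∀ f : ℝ → ℝ, (cfc f H).trace.re =
      ∑ i, spectralWeight hH 1 i * f (hH.eigenvalues i) := fun f => by
    rw [← re_trace_mul_cfc hH, one_mul]
  refine ⟨cfc (fun x : ℝ => max x 0) H, cfc (fun x : ℝ => max (-x) 0) H,
    posSemidef_cfc hH fun i => le_max_right _ _, posSemidef_cfc hH fun i => le_max_right _ _,
    ?_, ?_⟩
  · conv_lhs => rw [← hid]
    simp only [cfc_eq_conj hH]
    rw [← sub_mul, ← mul_sub, diagonal_sub]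
    congr 3
    ext i
    rw [← Complex.ofReal_sub]
    congr 1
    rcases le_total (hH.eigenvalues i) 0 with h | h
    · rw [max_eq_right h, max_eq_left (by linarith)]
      ring
    · rw [max_eq_left h, max_eq_right (by linarith)]
      ring
  · have h1 : Hᴴ * H = cfc (fun x : ℝ => x * x) H := by
      rw [← cfc_mul_matrix hH, hid, hH]
    rw [traceNorm, h1, cfc_comp_matrix hH, hone, hone, hone, ← Finset.sum_add_distrib]
    refine Finset.sum_congr rfl fun i _ => ?_
    rw [← mul_add, Real.sqrt_mul_self_eq_abs]
    congr 1
    rcases le_total (hH.eigenvalues i) 0 with h | h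
    · rw [max_eq_right h, max_eq_left (by linarith), abs_of_nonpos h]
      ring
    · rw [max_eq_left h, max_eq_right (by linarith), abs_of_nonneg h]
      ring

theorem eq_of_traceNorm_le {ρ σ : Matrix n n ℂ} (hρ : ρ ∈ states n) (hσ : σ ∈ states n)
    (h : traceNorm (ρ - σ) ≤ 0) : ρ = σ := by
  obtain ⟨P, N, hP, hN, hPN, ht⟩ := exists_jordan_decomposition (hρ.1.1.sub hσ.1.1)
  have h1 := (Complex.le_def.1 hP.trace_nonneg).1
  have h2 := (Complex.le_def.1 hN.trace_nonneg).1
  rw [Complex.zero_re] at h1 h2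
  rw [eq_zero_of_re_trace hP (by linarith), eq_zero_of_re_trace hN (by linarith), sub_zero,
    sub_eq_zero] at hPN
  exact hPN

/-- Two states at trace distance at most `ε` have a common mixture. -/
theorem exists_common_mixture {ρ σ : Matrix n n ℂ} (hρ : ρ ∈ states n) (hσ : σ ∈ states n) {ε : ℝ}
    (hε : 0 < ε) (h : 1 / 2 * traceNorm (ρ - σ) ≤ ε) :
    ∃ μ ∈ states n, ∃ ν ∈ states n, ρ + ε • ν = σ + ε • μ := by
  obtain ⟨P, N, hP, hN, hPN, ht⟩ := exists_jordan_decomposition (hρ.1.1.sub hσ.1.1)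
  have hteq : P.trace.re = N.trace.re := by
    have h1 := congrArg (fun M => M.trace.re) hPN
    simp only [trace_sub, Complex.sub_re, re_trace_of_mem_states hρ,
      re_trace_of_mem_states hσ] at h1
    linarith
  have hle : 0 ≤ ε - P.trace.re := by linarith
  -- Both Jordan parts have trace at most ε. Padding each with the same multiple of ρ raises the
  -- trace to ε, and the padding cancels in the final identity.
  have hmem : ∀ Q : Matrix n n ℂ, Q.PosSemidef → Q.trace.re = P.trace.re →
      ε⁻¹ • (Q + (ε - P.trace.re) • ρ) ∈ states n := fun Q hQ hQt => by
    refine mem_states_of_re ((hQ.add (hρ.1.smul hle)).smul (inv_nonneg.2 hε.le)) ?_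
    rw [re_trace_smul, trace_add, Complex.add_re, re_trace_smul, re_trace_of_mem_states hρ, hQt]
    field_simp
    ring
  refine ⟨_, hmem P hP rfl, _, hmem N hN hteq.symm, ?_⟩
  rw [smul_smul, smul_smul, mul_inv_cancel₀ hε.ne', one_smul, one_smul]
  have : ρ = σ + (P - N) := by rw [← hPN]; abel
  nth_rewrite 1 [this]
  abel

end TraceNorm

/-! ### Separable states dominating a given state. -/

section Separable

theorem kronecker_mem_states {a b : Type*} [Fintype a] [Fintype b] {α : Matrix a a ℂ}
    {β : Matrix b b ℂ} (hα : α ∈ states a)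
    (hβ : β ∈ states b) : α ⊗ₖ β ∈ states (a × b) :=
  ⟨hα.1.kronecker hβ.1, by rw [trace_kronecker, hα.2, hβ.2, one_mul]⟩

theorem convex_states (n : Type*) [Fintype n] : Convex ℝ (states n) := by
  intro x hx y hy p q hp hq hpq
  refine mem_states_of_re ((hx.1.smul hp).add (hy.1.smul hq)) ?_
  rw [trace_add, Complex.add_re, re_trace_smul, re_trace_smul, re_trace_of_mem_states hx,
    re_trace_of_mem_states hy]
  linarith

theorem separableStates_subset {a b : Type*} [Fintype a] [Fintype b] :
    separableStates a b ⊆ states (a × b) := by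
  refine convexHull_min ?_ (convex_states _)
  rintro γ ⟨α, hα, β, hβ, rfl⟩
  exact kronecker_mem_states hα hβ

theorem sum_kronecker_mem_separableStates {a b κ : Type*} [Fintype a] [Fintype b] [Fintype κ]
    {α : κ → Matrix a a ℂ} {β : κ → Matrix b b ℂ} (hα : ∀ k, (α k).PosSemidef)
    (hβ : ∀ k, (β k).PosSemidef)
    (htr : (∑ k, α k ⊗ₖ β k).trace.re = 1) : ∑ k, α k ⊗ₖ β k ∈ separableStates a b := by
  classical
  have hα0 : ∀ k, 0 ≤ (α k).trace.re := fun k => (Complex.le_def.1 (hα k).trace_nonneg).1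
  have hβ0 : ∀ k, 0 ≤ (β k).trace.re := fun k => (Complex.le_def.1 (hβ k).trace_nonneg).1
  have him : ∀ k, (α k).trace.im = 0 := fun k => (Complex.le_def.1 (hα k).trace_nonneg).2.symm
  set w : κ → ℝ := fun k => (α k).trace.re * (β k).trace.re with hw
  have hwsum : ∑ k, w k = 1 := by
    rw [← htr, trace_sum, Complex.re_sum]
    refine Finset.sum_congr rfl fun k _ => ?_
    rw [trace_kronecker, Complex.mul_re, him k, zero_mul, sub_zero]
  have hzero : ∀ k, w k = 0 → α k ⊗ₖ β k = 0 := by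
    intro k hk
    rcases mul_eq_zero.1 hk with h | h
    · rw [eq_zero_of_re_trace (hα k) h.le, zero_kronecker]
    · rw [eq_zero_of_re_trace (hβ k) h.le, kronecker_zero]
  have hmem : ∑ k with w k ≠ 0, w k • (((α k).trace.re⁻¹ • α k) ⊗ₖ ((β k).trace.re⁻¹ • β k)) ∈
      separableStates a b := by
    refine (convex_convexHull ℝ _).sum_mem (fun k _ => mul_nonneg (hα0 k) (hβ0 k)) ?_ ?_
    · rw [Finset.sum_filter_ne_zero, hwsum]
    · intro k hk
      have hk1 := (Finset.mem_filter.1 hk).2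
      refine subset_convexHull ℝ _ ⟨_, mem_states_of_re ((hα k).smul (inv_nonneg.2 (hα0 k))) ?_, _,
        mem_states_of_re ((hβ k).smul (inv_nonneg.2 (hβ0 k))) ?_, rfl⟩
      · rw [re_trace_smul, inv_mul_cancel₀ (left_ne_zero_of_mul hk1)]
      · rw [re_trace_smul, inv_mul_cancel₀ (right_ne_zero_of_mul hk1)]
  convert hmem using 1
  rw [Finset.sum_filter]
  refine Finset.sum_congr rfl fun k _ => ?_
  split_ifs with h
  · rw [smul_kronecker, kronecker_smul, smul_smul, smul_smul, hw]
    have h1 := left_ne_zero_of_mul h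
    have h2 := right_ne_zero_of_mul h
    have : (α k).trace.re * (β k).trace.re * (α k).trace.re⁻¹ * (β k).trace.re⁻¹ = 1 := by
      field_simp
    simp only [this, one_smul]
  · exact hzero k (not_not.1 h)

variable {a b : Type*} [Fintype a] [DecidableEq a] [Fintype b] [DecidableEq b]

/-- The pinching inequality. -/
theorem pinching_inequality {n κ : Type*} [Fintype n] [DecidableEq n] [Fintype κ]
    {ω : Matrix n n ℂ} (hω : ω.PosSemidef) {P : κ → Matrix n n ℂ} (hP : ∀ k, (P k)ᴴ = P k)
    (hsum : ∑ k, P k = 1) :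
    ((Fintype.card κ : ℝ) • ∑ k, P k * ω * P k - ω).PosSemidef := by
  -- This sum expands to twice the claimed difference, because the `P k` add up to 1.
  have h1 : (∑ i, ∑ j, (P i - P j) * ω * (P i - P j)).PosSemidef := by
    refine posSemidef_sum _ fun i _ => posSemidef_sum _ fun j _ => ?_
    have := hω.mul_mul_conjTranspose_same (P i - P j)
    rwa [conjTranspose_sub, hP, hP] at this
  have h2 : ∑ i, ∑ j, (P i - P j) * ω * (P i - P j) =
      (2 : ℝ) • ((Fintype.card κ : ℝ) • ∑ k, P k * ω * P k - ω) := by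
    have h3 : ∀ i j, (P i - P j) * ω * (P i - P j) =
        P i * ω * P i - P i * ω * P j - P j * ω * P i + P j * ω * P j := fun i j => by noncomm_ring
    simp only [h3, Finset.sum_add_distrib, Finset.sum_sub_distrib, ← Finset.mul_sum,
      ← Finset.sum_mul, hsum, Finset.sum_const, Finset.card_univ, mul_one, one_mul,
      mul_smul_comm, ← Finset.smul_sum]
    simp only [← Nat.cast_smul_eq_nsmul ℝ, two_smul]
    abel
  have h4 := h1.smul (show (0 : ℝ) ≤ 2⁻¹ by norm_num)
  rwa [h2, smul_smul, inv_mul_cancel₀ (by norm_num), one_smul] at h4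

/-- The compression of `ω` to the indices where `f` takes the value `k`. -/
def fiberCompression {n κ : Type*} [Fintype n] [DecidableEq n] [DecidableEq κ] (f : n → κ)
    (ω : Matrix n n ℂ) (k : κ) : Matrix n n ℂ :=
  diagonal (fun x => if f x = k then 1 else 0) * ω * diagonal (fun x => if f x = k then 1 else 0)

theorem fiberCompression_pinching {n κ : Type*} [Fintype n] [DecidableEq n] [Fintype κ]
    [DecidableEq κ] (f : n → κ) {ω : Matrix n n ℂ} (hω : ω.PosSemidef) :
    ((Fintype.card κ : ℝ) • ∑ k, fiberCompression f ω k - ω).PosSemidef := by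
  refine pinching_inequality hω (fun k => ?_) ?_
  · rw [diagonal_conjTranspose]
    congr 1
    ext x
    simp only [Pi.star_apply]
    split_ifs <;> simp
  · ext x y
    rw [Matrix.sum_apply]
    by_cases h : x = y <;> simp [h, diagonal, one_apply]

theorem trace_sum_fiberCompression {n κ : Type*} [Fintype n] [DecidableEq n] [Fintype κ]
    [DecidableEq κ] (f : n → κ) (ω : Matrix n n ℂ) :
    (∑ k, fiberCompression f ω k).trace = ω.trace := by
  refine Finset.sum_congr rfl fun x _ => ?_
  rw [diag_apply, Matrix.sum_apply]
  simp [fiberCompression, diagonal_mul, mul_diagonal]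

theorem posSemidef_diagonal_ite {n : Type*} [DecidableEq n] (k : n) :
    (diagonal fun x => if x = k then (1 : ℂ) else 0).PosSemidef :=
  PosSemidef.diagonal fun x => by
    simp only [Pi.zero_apply]
    split_ifs <;> simp

/-- Pinching in a basis of the first factor leaves the blocks |i⟩⟨i| ⊗ ω_ii, so the pinched state is
separable, at the cost of a factor d_A. -/
theorem exists_separable_ge_left {ω : Matrix (a × b) (a × b) ℂ} (hω : ω ∈ states (a × b)) :
    ∃ γ ∈ separableStates a b, ((Fintype.card a : ℝ) • γ - ω).PosSemidef := by
  refine ⟨_, ?_, fiberCompression_pinching Prod.fst hω.1⟩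
  have h : ∀ i, fiberCompression Prod.fst ω i =
      (diagonal fun x => if x = i then (1 : ℂ) else 0) ⊗ₖ ω.submatrix (Prod.mk i) (Prod.mk i) := by
    intro i
    ext ⟨x, y⟩ ⟨x', y'⟩
    simp only [fiberCompression, diagonal_mul, mul_diagonal, kroneckerMap_apply, submatrix_apply]
    rcases eq_or_ne x i with rfl | h1
    · rcases eq_or_ne x' x with rfl | h2
      · simp
      · simp [h2, h2.symm]
    · simp [h1, diagonal_apply]
  have ht := trace_sum_fiberCompression Prod.fst ω
  rw [hω.2] at ht
  simp only [h] at ht ⊢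
  exact sum_kronecker_mem_separableStates (fun i => posSemidef_diagonal_ite i)
    (fun i => hω.1.submatrix _) (by rw [ht, Complex.one_re])

theorem exists_separable_ge_right {ω : Matrix (a × b) (a × b) ℂ} (hω : ω ∈ states (a × b)) :
    ∃ γ ∈ separableStates a b, ((Fintype.card b : ℝ) • γ - ω).PosSemidef := by
  refine ⟨_, ?_, fiberCompression_pinching Prod.snd hω.1⟩
  have h : ∀ j, fiberCompression Prod.snd ω j = ω.submatrix (fun i => (i, j)) (fun i => (i, j)) ⊗ₖ
      (diagonal fun x => if x = j then (1 : ℂ) else 0) := by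
    intro j
    ext ⟨x, y⟩ ⟨x', y'⟩
    simp only [fiberCompression, diagonal_mul, mul_diagonal, kroneckerMap_apply, submatrix_apply]
    rcases eq_or_ne y j with rfl | h1
    · rcases eq_or_ne y' y with rfl | h2
      · simp
      · simp [h2, h2.symm]
    · simp [h1, diagonal_apply]
  have ht := trace_sum_fiberCompression Prod.snd ω
  rw [hω.2] at ht
  simp only [h] at ht ⊢
  exact sum_kronecker_mem_separableStates (fun i => hω.1.submatrix _)
    (fun i => posSemidef_diagonal_ite i) (by rw [ht, Complex.one_re])

theorem exists_separable_ge {ω : Matrix (a × b) (a × b) ℂ} (hω : ω ∈ states (a × b)) :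
    ∃ γ ∈ separableStates a b,
      (min (Fintype.card a : ℝ) (Fintype.card b : ℝ) • γ - ω).PosSemidef := by
  rcases min_choice (Fintype.card a : ℝ) (Fintype.card b : ℝ) with h | h
  · rw [h]
    exact exists_separable_ge_left hω
  · rw [h]
    exact exists_separable_ge_right hω

theorem maximallyMixed_mem_separableStates [Nonempty a] [Nonempty b] :
    ((Fintype.card a * Fintype.card b : ℕ) : ℝ)⁻¹ • (1 : Matrix (a × b) (a × b) ℂ) ∈
      separableStates a b := by
  have h : ((Fintype.card a * Fintype.card b : ℕ) : ℝ)⁻¹ • (1 : Matrix (a × b) (a × b) ℂ) =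
      ∑ _k : Unit, (((Fintype.card a * Fintype.card b : ℕ) : ℝ)⁻¹ • (1 : Matrix a a ℂ)) ⊗ₖ
        (1 : Matrix b b ℂ) := by
    simp [smul_kronecker]
  have hd : ((Fintype.card a * Fintype.card b : ℕ) : ℝ) ≠ 0 :=
    Nat.cast_ne_zero.2 (mul_pos Fintype.card_pos Fintype.card_pos).ne'
  rw [h]
  refine sum_kronecker_mem_separableStates
    (fun _ => PosSemidef.one.smul (inv_nonneg.2 (Nat.cast_nonneg _))) (fun _ => PosSemidef.one) ?_
  rw [← h, re_trace_smul, trace_one, Fintype.card_prod, Complex.natCast_re, inv_mul_cancel₀ hd]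

end Separable

/-! ### The distance to the separable states and its continuity. -/

section Distance

variable {a b : Type*} [Fintype a] [DecidableEq a] [Fintype b] [DecidableEq b]

/-- The mixture of `γ` with the maximally mixed state, which has weight `s`. -/
def depolarize (s : ℝ) (γ : Matrix (a × b) (a × b) ℂ) : Matrix (a × b) (a × b) ℂ :=
  (1 - s) • γ + s • (((Fintype.card a * Fintype.card b : ℕ) : ℝ)⁻¹ • 1)

theorem depolarize_mem [Nonempty a] [Nonempty b] {s : ℝ} (hs0 : 0 ≤ s) (hs1 : s ≤ 1)
    {γ : Matrix (a × b) (a × b) ℂ} (hγ : γ ∈ separableStates a b) :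
    depolarize s γ ∈ separableStates a b :=
  convex_convexHull ℝ _ hγ maximallyMixed_mem_separableStates (by linarith) hs0 (by ring)

theorem depolarize_posDef [Nonempty a] [Nonempty b] {s : ℝ} (hs0 : 0 < s) (hs1 : s ≤ 1)
    {γ : Matrix (a × b) (a × b) ℂ} (hγ : γ.PosSemidef) : (depolarize s γ).PosDef := by
  have hd : (0 : ℝ) < ((Fintype.card a * Fintype.card b : ℕ) : ℝ)⁻¹ :=
    inv_pos.2 (Nat.cast_pos.2 (mul_pos Fintype.card_pos Fintype.card_pos))
  exact PosDef.posSemidef_add (hγ.smul (by linarith)) ((PosDef.one.smul hd).smul hs0)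

theorem depolarize_sub_smul_posSemidef {s : ℝ} (hs0 : 0 ≤ s) (γ : Matrix (a × b) (a × b) ℂ) :
    (depolarize s γ - (1 - s) • γ).PosSemidef := by
  rw [depolarize, add_sub_cancel_left]
  exact (PosSemidef.one.smul (inv_nonneg.2 (Nat.cast_nonneg _))).smul hs0

theorem depolarize_sub_one_posSemidef {s : ℝ} (hs1 : s ≤ 1) {γ : Matrix (a × b) (a × b) ℂ}
    (hγ : γ.PosSemidef) :
    (depolarize s γ - (s * ((Fintype.card a * Fintype.card b : ℕ) : ℝ)⁻¹) •
      (1 : Matrix (a × b) (a × b) ℂ)).PosSemidef := by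
  rw [depolarize, smul_smul, add_sub_cancel_right]
  exact hγ.smul (by linarith)

/-- The properties of the real number `x = bsDist SEP ρ` used for the continuity bound. -/
structure IsSeparableDist (ρ : Matrix (a × b) (a × b) ℂ) (x : ℝ) : Prop where
  bsDist_eq : bsDist (separableStates a b) ρ = (x : EReal)
  nonneg : 0 ≤ x
  le_log : x ≤ Real.log (min (Fintype.card a : ℝ) (Fintype.card b : ℝ))
  le_relTrace : ∀ γ ∈ separableStates a b, γ.PosDef → x ≤ relTrace ρ γ
  exists_lt : ∀ δ > 0, ∃ γ ∈ separableStates a b, ∀ s, 0 < s → s < 1 →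
    relTrace ρ (depolarize s γ) < x + δ - Real.log (1 - s)

theorem relTrace_separable_nonneg {ρ γ : Matrix (a × b) (a × b) ℂ} (hρ : ρ ∈ states (a × b))
    (hγ : γ ∈ separableStates a b) (hpos : γ.PosDef) : 0 ≤ relTrace ρ γ :=
  relTrace_nonneg hρ.1 hpos (by
    rw [re_trace_of_mem_states hρ, re_trace_of_mem_states (separableStates_subset hγ)])

variable [Nonempty a] [Nonempty b]

theorem relTrace_depolarize_le {ρ γ : Matrix (a × b) (a × b) ℂ} (hρ : ρ ∈ states (a × b))
    (hγ : γ ∈ separableStates a b)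
    (hker : LinearMap.ker γ.mulVecLin ≤ LinearMap.ker ρ.mulVecLin) {s : ℝ} (hs0 : 0 < s)
    (hs1 : s < 1) :
    relTrace ρ (depolarize s γ) ≤
      (ρ * logM (sqrtM ρ * pinvM γ * sqrtM ρ)).trace.re - Real.log (1 - s) := by
  have hγs := (separableStates_subset hγ).1
  have h := relTrace_le_of_smul_le hρ.1 hγs hker (depolarize_posDef hs0 hs1.le hγs)
    (sub_pos.2 hs1) (depolarize_sub_smul_posSemidef hs0.le γ)
  rwa [re_trace_of_mem_states hρ, mul_one] at h

/-- The weight 1 - e^{-δ} is chosen so that depolarizing with it costs exactly δ. -/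
theorem one_sub_exp_neg_mem {δ : ℝ} (hδ : 0 < δ) :
    0 < 1 - Real.exp (-δ) ∧ 1 - Real.exp (-δ) < 1 ∧ Real.log (1 - (1 - Real.exp (-δ))) = -δ := by
  have h1 : Real.exp (-δ) < 1 := (Real.exp_lt_exp.2 (by linarith)).trans_eq Real.exp_zero
  have h2 := Real.exp_pos (-δ)
  refine ⟨by linarith, by linarith, ?_⟩
  rw [sub_sub_cancel, Real.log_exp]

theorem bsEntropy_nonneg {ρ γ : Matrix (a × b) (a × b) ℂ} (hρ : ρ ∈ states (a × b))
    (hγ : γ ∈ separableStates a b) : 0 ≤ bsEntropy ρ γ := by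
  rw [bsEntropy]
  split_ifs with hker
  · rw [EReal.coe_nonneg]
    refine le_of_forall_pos_le_add fun δ hδ => ?_
    obtain ⟨h0, h1, hl⟩ := one_sub_exp_neg_mem hδ
    have h2 := relTrace_depolarize_le hρ hγ hker h0 h1
    have h3 := relTrace_separable_nonneg hρ (depolarize_mem h0.le h1.le hγ)
      (depolarize_posDef h0 h1.le (separableStates_subset hγ).1)
    rw [hl] at h2
    linarith
  · exact le_top

theorem exists_isSeparableDist {ρ : Matrix (a × b) (a × b) ℂ} (hρ : ρ ∈ states (a × b)) :
    ∃ x : ℝ, IsSeparableDist ρ x := by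
  set k : ℝ := min (Fintype.card a : ℝ) (Fintype.card b : ℝ) with hk
  have hkpos : 0 < k :=
    lt_min (Nat.cast_pos.2 Fintype.card_pos) (Nat.cast_pos.2 Fintype.card_pos)
  have hle : ∀ γ ∈ separableStates a b, γ.PosDef →
      bsDist (separableStates a b) ρ ≤ (relTrace ρ γ : EReal) := fun γ hγ hpos => by
    rw [← bsEntropy_eq_relTrace hρ.1 hpos]
    exact iInf₂_le γ hγ
  have hbound : ∀ δ > 0, bsDist (separableStates a b) ρ ≤ ((Real.log k + δ : ℝ) : EReal) := by
    intro δ hδ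
    obtain ⟨γ, hγ, hγk⟩ := exists_separable_ge hρ
    obtain ⟨h0, h1, hl⟩ := one_sub_exp_neg_mem hδ
    set s := 1 - Real.exp (-δ)
    have hs : 0 < 1 - s := sub_pos.2 h1
    have hpos := depolarize_posDef h0 h1.le (separableStates_subset hγ).1
    refine (hle _ (depolarize_mem h0.le h1.le hγ) hpos).trans (EReal.coe_le_coe_iff.2 ?_)
    -- From ρ ≤ kγ and (1 - s)γ ≤ `depolarize s γ`.
    have h2 : ((k / (1 - s)) • depolarize s γ - ρ).PosSemidef := by
      have h3 := ((depolarize_sub_smul_posSemidef h0.le γ).smul (div_pos hkpos hs).le).add hγk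
      rwa [smul_sub, smul_smul, div_mul_cancel₀ _ hs.ne', sub_add_sub_cancel] at h3
    have h4 := relTrace_le_log hρ.1 hpos h2
    rw [re_trace_of_mem_states hρ, mul_one, Real.log_div hkpos.ne' hs.ne', hl] at h4
    linarith
  have hnn : 0 ≤ bsDist (separableStates a b) ρ := le_iInf₂ fun γ hγ => bsEntropy_nonneg hρ hγ
  have hx : ((bsDist (separableStates a b) ρ).toReal : EReal) = bsDist (separableStates a b) ρ :=
    EReal.coe_toReal (ne_top_of_le_ne_top (EReal.coe_ne_top _) (hbound 1 one_pos))
      (ne_bot_of_le_ne_bot EReal.zero_ne_bot hnn)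
  generalize (bsDist (separableStates a b) ρ).toReal = x at hx
  rw [← hx] at hnn hbound hle
  refine ⟨x, hx.symm, EReal.coe_nonneg.1 hnn, le_of_forall_pos_le_add fun δ hδ =>
    EReal.coe_le_coe_iff.1 (hbound δ hδ), fun γ hγ hpos => EReal.coe_le_coe_iff.1 (hle γ hγ hpos),
    fun δ hδ => ?_⟩
  have hlt : bsDist (separableStates a b) ρ < ((x + δ : ℝ) : EReal) := by
    rw [← hx, EReal.coe_lt_coe_iff]
    linarith
  simp only [bsDist, iInf_lt_iff] at hlt
  obtain ⟨γ, hγ, hlt⟩ := hlt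
  -- The near-optimal γ may be singular and is fixed before s, so that s can later be matched to p.
  refine ⟨γ, hγ, fun s hs0 hs1 => ?_⟩
  rw [bsEntropy] at hlt
  split_ifs at hlt with hker
  · have h1 := relTrace_depolarize_le hρ hγ hker hs0 hs1
    have h2 := EReal.coe_lt_coe_iff.1 hlt
    linarith
  · exact absurd hlt not_top_lt

namespace IsSeparableDist

theorem exists_posDef {ρ : Matrix (a × b) (a × b) ℂ} {x : ℝ} (h : IsSeparableDist ρ x) {δ : ℝ}
    (hδ : 0 < δ) : ∃ γ ∈ separableStates a b, γ.PosDef ∧ relTrace ρ γ ≤ x + δ := by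
  obtain ⟨γ, hγ, hlt⟩ := h.exists_lt (δ / 2) (half_pos hδ)
  obtain ⟨h0, h1, hl⟩ := one_sub_exp_neg_mem (half_pos hδ)
  refine ⟨_, depolarize_mem h0.le h1.le hγ,
    depolarize_posDef h0 h1.le (separableStates_subset hγ).1, ?_⟩
  have := hlt _ h0 h1
  rw [hl] at this
  linarith

theorem convex {ρ ν : Matrix (a × b) (a × b) ℂ} {x z w p : ℝ} (hρ : ρ.PosSemidef)
    (hν : ν.PosSemidef) (hx : IsSeparableDist ρ x) (hz : IsSeparableDist ν z) (hp0 : 0 ≤ p)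
    (hp1 : p < 1) (hw : IsSeparableDist ((1 - p) • ρ + p • ν) w) : w ≤ (1 - p) * x + p * z := by
  refine le_of_forall_pos_le_add fun δ hδ => ?_
  obtain ⟨γ₁, hγ₁, hpos₁, h₁⟩ := hx.exists_posDef hδ
  obtain ⟨γ₂, hγ₂, hpos₂, h₂⟩ := hz.exists_posDef hδ
  have hq : 0 < 1 - p := sub_pos.2 hp1
  have hmem : (1 - p) • γ₁ + p • γ₂ ∈ separableStates a b :=
    convex_convexHull ℝ _ hγ₁ hγ₂ hq.le hp0 (by ring)
  have hpos : ((1 - p) • γ₁ + p • γ₂).PosDef :=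
    (hpos₁.smul hq).add_posSemidef (hpos₂.posSemidef.smul hp0)
  have h3 := hw.le_relTrace _ hmem hpos
  have h4 := relTrace_convex hρ hν hpos₁ hpos₂ hq hp0
  have h5 := mul_le_mul_of_nonneg_left h₁ hq.le
  have h6 := mul_le_mul_of_nonneg_left h₂ hp0
  linarith

/-- A depolarized near-optimizer for the mixture is used as a competitor for both σ and μ. It
dominates s/d, so the loss is (d/s) h(p) - log(1 - s). The argument works for every s in (0,1); s =
p^{1/d} produces g_d. -/
theorem almost_concave (hd : 2 ≤ Fintype.card a * Fintype.card b)
    {σ μ : Matrix (a × b) (a × b) ℂ} {y z w p : ℝ} (hσ : σ ∈ states (a × b))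
    (hμ : μ ∈ states (a × b)) (hy : IsSeparableDist σ y) (hz : IsSeparableDist μ z) (hp0 : 0 < p)
    (hp1 : p < 1) (hw : IsSeparableDist ((1 - p) • σ + p • μ) w) :
    (1 - p) * y + p * z - gFun (Fintype.card a * Fintype.card b) p ≤ w := by
  set d := Fintype.card a * Fintype.card b with hdef
  have hdpos : (0 : ℝ) < (d : ℝ) := Nat.cast_pos.2 (by omega)
  set s : ℝ := p ^ (1 / (d : ℝ)) with hs
  have hs0 : 0 < s := Real.rpow_pos_of_pos hp0 _
  have hs1 : s < 1 := Real.rpow_lt_one hp0.le hp1 (by positivity)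
  refine le_of_forall_pos_le_add fun δ hδ => ?_
  obtain ⟨γ, hγ, hlt⟩ := hw.exists_lt δ hδ
  have hγs := (separableStates_subset hγ).1
  have hmem := depolarize_mem hs0.le hs1.le hγ
  have hpos := depolarize_posDef hs0 hs1.le hγs
  have h1 := hlt s hs0 hs1
  have h2 := relTrace_almost_concave hμ hσ hpos
    (re_trace_of_mem_states (separableStates_subset hmem)).le hp0 hp1
    (mul_pos hs0 (inv_pos.2 hdpos)) (depolarize_sub_one_posSemidef hs1.le hγs)
  rw [add_comm (p • μ)] at h2
  have h3 := mul_le_mul_of_nonneg_left (hy.le_relTrace _ hmem hpos) (sub_pos.2 hp1).le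
  have h4 := mul_le_mul_of_nonneg_left (hz.le_relTrace _ hmem hpos) hp0.le
  have h5 : gFun d p = (s * (d : ℝ)⁻¹)⁻¹ * Real.binEntropy p - Real.log (1 - s) := by
    rw [gFun, if_neg hp0.ne', mul_inv, inv_inv, div_eq_mul_inv, mul_comm (d : ℝ)]
  rw [h5]
  linarith

theorem sub_le (hd : 2 ≤ Fintype.card a * Fintype.card b) {ρ σ μ ν : Matrix (a × b) (a × b) ℂ}
    {x y ε : ℝ} (hρ : ρ ∈ states (a × b)) (hσ : σ ∈ states (a × b)) (hμ : μ ∈ states (a × b))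
    (hν : ν ∈ states (a × b)) (hx : IsSeparableDist ρ x) (hy : IsSeparableDist σ y) (hε : 0 < ε)
    (hmix : ρ + ε • ν = σ + ε • μ) :
    y - x ≤ ε * Real.log (min (Fintype.card a : ℝ) (Fintype.card b : ℝ)) +
      (1 + ε) * gFun (Fintype.card a * Fintype.card b) (ε / (1 + ε)) := by
  have hε1 : 0 < 1 + ε := by linarith
  set p := ε / (1 + ε) with hp
  have hp0 : 0 < p := div_pos hε hε1
  have hp1 : p < 1 := (div_lt_one hε1).2 (by linarith)
  have hq : 1 - p = (1 + ε)⁻¹ := by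
    rw [hp]
    field_simp
    ring
  have hpe : p = (1 + ε)⁻¹ * ε := by rw [hp, div_eq_inv_mul]
  have hmix' : (1 - p) • ρ + p • ν = (1 - p) • σ + p • μ := by
    rw [hq, hpe, mul_smul, mul_smul, ← smul_add, ← smul_add, hmix]
  obtain ⟨z, hz⟩ := exists_isSeparableDist hμ
  obtain ⟨z', hz'⟩ := exists_isSeparableDist hν
  obtain ⟨w, hw⟩ := exists_isSeparableDist
    (convex_states _ hρ hν (sub_pos.2 hp1).le hp0.le (by ring))
  have h1 := hx.convex hρ.1 hν.1 hz' hp0.le hp1 hw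
  rw [hmix'] at hw
  have h2 := hy.almost_concave hd hσ hμ hz hp0 hp1 hw
  -- The mixture's distance lies between (1 - p)y + pz - g_d(p) and (1 - p)x + pz', with z ≥ 0 and
  -- z' ≤ log min(d_A, d_B). Multiplying by 1 + ε = 1/(1 - p) then gives the bound.
  have h3 := mul_le_mul_of_nonneg_left hz'.le_log hp0.le
  have h4 := mul_nonneg hp0.le hz.nonneg
  have h5 : (1 - p) * (y - x) ≤ p * Real.log (min (Fintype.card a : ℝ) (Fintype.card b : ℝ)) +
      gFun (Fintype.card a * Fintype.card b) p := by linarith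
  have h6 := mul_le_mul_of_nonneg_left h5 hε1.le
  have h7 : (1 + ε) * (1 - p) = 1 := by rw [hq, mul_inv_cancel₀ hε1.ne']
  have h8 : (1 + ε) * p = ε := by rw [hp, mul_div_cancel₀ _ hε1.ne']
  rwa [← mul_assoc, h7, one_mul, mul_add, ← mul_assoc, h8] at h6

end IsSeparableDist

end Distance

end BSEntanglement

end

theorem mainTheorem12 {a b : Type*} [Fintype a] [DecidableEq a] [Fintype b] [DecidableEq b]
    (hd : 2 ≤ Fintype.card a * Fintype.card b)
    (ε : ℝ) (hε0 : 0 ≤ ε) (hε1 : ε ≤ 1)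
    (ρ σ : Matrix (a × b) (a × b) ℂ)
    (hρ : ρ ∈ BSEntanglement.states (a × b)) (hσ : σ ∈ BSEntanglement.states (a × b))
    (hρσ : 1 / 2 * BSEntanglement.traceNorm (ρ - σ) ≤ ε) :
    ∃ x y : ℝ,
      BSEntanglement.bsDist (BSEntanglement.separableStates a b) ρ = (x : EReal) ∧
      BSEntanglement.bsDist (BSEntanglement.separableStates a b) σ = (y : EReal) ∧
      |x - y| ≤ ε * Real.log (min (Fintype.card a : ℝ) (Fintype.card b : ℝ)) +
        (1 + ε) * BSEntanglement.gFun (Fintype.card a * Fintype.card b) (ε / (1 + ε)) := by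
  have hne : Fintype.card a ≠ 0 ∧ Fintype.card b ≠ 0 :=
    mul_ne_zero_iff.1 (show Fintype.card a * Fintype.card b ≠ 0 by omega)
  have : Nonempty a := Fintype.card_pos_iff.1 (Nat.pos_of_ne_zero hne.1)
  have : Nonempty b := Fintype.card_pos_iff.1 (Nat.pos_of_ne_zero hne.2)
  obtain ⟨x, hx⟩ := BSEntanglement.exists_isSeparableDist hρ
  obtain ⟨y, hy⟩ := BSEntanglement.exists_isSeparableDist hσ
  refine ⟨x, y, hx.bsDist_eq, hy.bsDist_eq, ?_⟩
  -- The common mixture requires division by ε; at ε = 0 the states coincide and the bound is g_d(0)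
  -- = 0.
  rcases hε0.eq_or_lt with rfl | hε
  · obtain rfl := BSEntanglement.eq_of_traceNorm_le hρ hσ (by linarith)
    have hxy : x = y := EReal.coe_injective (hx.bsDist_eq.symm.trans hy.bsDist_eq)
    simp [hxy, BSEntanglement.gFun]
  · obtain ⟨μ, hμ, ν, hν, hmix⟩ := BSEntanglement.exists_common_mixture hρ hσ hε hρσ
    rw [abs_le']
    constructor
    · exact hy.sub_le hd hσ hρ hν hμ hx hε hmix.symm
    · have := hx.sub_le hd hρ hσ hμ hν hy hε hmix
      linarith
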